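/- Let $1\le r<n$, $A,G\in\mathbb{R}^{n\times n}$, $C\in\mathbb{R}^{p\times n}$, $H\in\mathbb{R}^{p\times p}$ with $HH^\top$ positive definite. Let $\lambda_1,\dots,\lambda_n$ be the complex eigenvalues of $A$, listed with algebraic multiplicity and with $\mathrm{Re}\,\lambda_1\ge\dots\ge\mathrm{Re}\,\lambda_n$, and suppose that $\mathrm{Re}\,\lambda_r>\mathrm{Re}\,\lambda_{r+1}$. Suppose that $(A,G)$ is controllable and $(C,A)$ is observable. Let $\mathcal{U}$ be the set of all $U\in\mathbb{R}^{n\times r}$ with $U^\top U=I_r$ of the form $U=\Psi\begin{bmatrix}K\\ 0\end{bmatrix}$, where $K\in\mathbb{C}^{r\times r}$ is invertible and $\Psi\in\mathbb{C}^{n\times n}$ is an invertible matrix of (generalized) eigenvectors of $A$ such that $\Psi^{-1}A\Psi$ is a Jordan form of $A$ whose diagonal entries have non-increasing real parts. Consider on $[0,\infty)$ the low-rank Kalman–Bucy filter equations $$\dot U=(I_n-UU^\top)AU,$$ $$\dot{\tilde R}=A_U\tilde R+\tilde RA_U^\top+G_UG_U^\top-\tilde RC_U^\top(HH^\top)^{-1}C_U\tilde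 R,$$ where $A_U=U^\top AU$, $G_U=U^\top G$, $C_U=CU$, with initial values $U(0)^\top U(0)=I_r$ and $\tilde R(0)$ positive definite, and put $\tilde P(t)=U(t)\tilde R(t)U(t)^\top$. Then there are matrices $\tilde R_{U}\in\mathbb{R}^{r\times r}$ for $U\in\mathcal{U}$ and a matrix $\tilde P_r\in\mathbb{R}^{n\times n}$ such that: 1. For each $\bar U\in\mathcal{U}$ and each positive definite $R_0\in\mathbb{R}^{r\times r}$ the equations have a solution on $[0,\infty)$ with $U(0)=\bar U$ and $\tilde R(0)=R_0$, and along every solution with $U(0)=\bar U$ and $\tilde R(0)$ positive definite, $\tilde R(t)\to\tilde R_{\bar U}$ as $t\to\infty$. 2. Along every solution with $U(0)\in\mathcal{U}$ and $\tilde R(0)$ positive definite, $\tilde P(t)\to\tilde P_r$ as $t\to\infty$. 3. For all $U_1,U_2\in\mathcal{U}$, $\;U_1\tilde R_{U_1}U_1^\top=U_2\tilde R_{U_2}U_2^\top=\tilde P_r$. -/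

import Mathlib

open Filter Topology

namespace LRKB

/-- `lam 0, …, lam (n-1)` are the complex eigenvalues of the real matrix `A`, listed with algebraic
multiplicity and with non-increasing real parts. -/
def IsOrderedSpectrum {n : ℕ} (A : Matrix (Fin n) (Fin n) ℝ) (lam : Fin n → ℂ) : Prop :=
  (A.map Complex.ofReal).charpoly.roots = Finset.univ.val.map lam ∧
    Antitone fun i => (lam i).re

/-- `Λ` is a Jordan matrix: its only nonzero off-diagonal entries are ones on the superdiagonal,
between equal diagonal entries; the diagonal entries have non-increasing real parts. -/
def IsOrderedJordanMatrix {n : ℕ} (Λ : Matrix (Fin n) (Fin n) ℂ) : Prop :=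
  (∀ i j, i ≠ j → Λ i j ≠ 0 → i.val + 1 = j.val ∧ Λ i i = Λ j j ∧ Λ i j = 1) ∧
    Antitone fun i => (Λ i i).re

/-- The columns of `Ψ` are a basis of (generalized) eigenvectors of `A` over `ℂ`, ordered by
non-increasing real part of the eigenvalue, so that `Ψ⁻¹ A Ψ` is a Jordan form of `A`. -/
def IsOrderedJordanBasis {n : ℕ} (A : Matrix (Fin n) (Fin n) ℝ)
    (Ψ : Matrix (Fin n) (Fin n) ℂ) : Prop :=
  IsUnit Ψ.det ∧ IsOrderedJordanMatrix (Ψ⁻¹ * A.map Complex.ofReal * Ψ)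

/-- The `n × r` block matrix with upper block `K` and lower block zero. -/
def padZero (n : ℕ) {r : ℕ} (K : Matrix (Fin r) (Fin r) ℂ) : Matrix (Fin n) (Fin r) ℂ :=
  Matrix.of fun i j => if h : i.val < r then K ⟨i.val, h⟩ j else 0

/-- The Stiefel manifold of real `n × r` matrices with orthonormal columns. -/
def stiefel (n r : ℕ) : Set (Matrix (Fin n) (Fin r) ℝ) :=
  {U | U.transpose * U = 1}

/-- The stable equilibrium set of the Oja flow: the elements of the Stiefel manifold of the form
`Ψ [K; 0]`, with `Ψ` an ordered Jordan basis and `K` invertible. A rescaling of the columns of `Ψ`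
(for instance to norm one) is absorbed by `K`. -/
def ojaStableSet {n : ℕ} (r : ℕ) (A : Matrix (Fin n) (Fin n) ℝ) :
    Set (Matrix (Fin n) (Fin r) ℝ) :=
  {U | U ∈ stiefel n r ∧ ∃ (Ψ : Matrix (Fin n) (Fin n) ℂ) (K : Matrix (Fin r) (Fin r) ℂ),
    IsOrderedJordanBasis A Ψ ∧ IsUnit K.det ∧ U.map Complex.ofReal = Ψ * padZero n K}

/-- `(A, G)` is controllable: `[G, AG, …, A^(n-1) G]` has rank `n`. -/
def IsControllable {n m : ℕ} (A : Matrix (Fin n) (Fin n) ℝ) (G : Matrix (Fin n) (Fin m) ℝ) : Prop :=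
  (Matrix.of fun (i : Fin n) (kj : Fin n × Fin m) => (A ^ kj.1.val * G) i kj.2).rank = n

/-- `(C, A)` is observable: the matrix with block rows `C, CA, …, C A^(n-1)` has rank `n`. -/
def IsObservable {n p : ℕ} (C : Matrix (Fin p) (Fin n) ℝ) (A : Matrix (Fin n) (Fin n) ℝ) : Prop :=
  (Matrix.of fun (ki : Fin n × Fin p) (j : Fin n) => (C * A ^ ki.1.val) ki.2 j).rank = n

/-- The right-hand side `(I - U Uᵀ) A U` of the Oja flow. -/
def ojaField {n r : ℕ} (A : Matrix (Fin n) (Fin n) ℝ) (U : Matrix (Fin n) (Fin r) ℝ) :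
    Matrix (Fin n) (Fin r) ℝ :=
  (1 - U * U.transpose) * A * U

/-- The right-hand side `a R + R aᵀ + g gᵀ - R cᵀ (H Hᵀ)⁻¹ c R` of a Riccati equation. -/
noncomputable def riccatiField {r m p : ℕ} (a : Matrix (Fin r) (Fin r) ℝ)
    (g : Matrix (Fin r) (Fin m) ℝ) (c : Matrix (Fin p) (Fin r) ℝ) (H : Matrix (Fin p) (Fin p) ℝ)
    (R : Matrix (Fin r) (Fin r) ℝ) : Matrix (Fin r) (Fin r) ℝ :=
  a * R + R * a.transpose + g * g.transpose
    - R * c.transpose * (H * H.transpose)⁻¹ * c * R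

/-- `M` is differentiable on `[0, ∞)` (one-sidedly at `0`), entry by entry, with derivative `M'`. -/
def HasDerivOnHalfLine {k l : ℕ} (M M' : ℝ → Matrix (Fin k) (Fin l) ℝ) : Prop :=
  ∀ t, 0 ≤ t → ∀ i j, HasDerivWithinAt (fun s => M s i j) (M' t i j) (Set.Ici 0) t

/-- `(U, R)` solves on `[0, ∞)` the equations of the low-rank Kalman--Bucy filter: the Oja flow
for `U`, and the Riccati equation with coefficients `Uᵀ A U`, `Uᵀ G`, `C U` for `R`; initially `U`
lies in the Stiefel manifold and `R` is positive definite. -/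
structure IsFilterSolution {n r p : ℕ} (A G : Matrix (Fin n) (Fin n) ℝ)
    (C : Matrix (Fin p) (Fin n) ℝ) (H : Matrix (Fin p) (Fin p) ℝ)
    (U : ℝ → Matrix (Fin n) (Fin r) ℝ) (R : ℝ → Matrix (Fin r) (Fin r) ℝ) : Prop where
  stiefel_zero : U 0 ∈ stiefel n r
  posDef_zero : (R 0).PosDef
  oja : HasDerivOnHalfLine U fun t => ojaField A (U t)
  riccati : HasDerivOnHalfLine R fun t =>
    riccatiField ((U t).transpose * A * U t) ((U t).transpose * G) (C * U t) H (R t)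

/-- `R` is the steady-state reduced covariance at `U₀`: for every positive definite `R₀` the filter
equations have a solution that starts at `(U₀, R₀)`, and along each solution that starts at `U₀`
the reduced covariance converges to `R`. -/
def IsSteadyStateCovariance {n r p : ℕ} (A G : Matrix (Fin n) (Fin n) ℝ)
    (C : Matrix (Fin p) (Fin n) ℝ) (H : Matrix (Fin p) (Fin p) ℝ)
    (U₀ : Matrix (Fin n) (Fin r) ℝ) (R : Matrix (Fin r) (Fin r) ℝ) : Prop :=
  (∀ R₀ : Matrix (Fin r) (Fin r) ℝ, R₀.PosDef →
    ∃ Ut Rt, IsFilterSolution A G C H Ut Rt ∧ Ut 0 = U₀ ∧ Rt 0 = R₀) ∧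
  ∀ Ut Rt, IsFilterSolution A G C H Ut Rt → Ut 0 = U₀ → Tendsto Rt atTop (𝓝 R)

end LRKB

/-! A point `U` of the stable set spans a real `A`-invariant subspace, because Jordan matrices are
upper triangular. So the Oja field vanishes at `U`, the flow rests there by uniqueness, and `R`
solves a Riccati equation `R' = aR + Raᵀ + Q - RSR` with constant coefficients. Since `A ^ k * U = U
* a ^ k`, the pair `(S, a)` inherits observability (`reduced_observable`).

The analytic core is `exists_riccati_limit`. The Riccati flow preserves the Loewner order
(`posSemidef_sub_of_riccati`). Inverting a small multiple of the solution of a shifted Lyapunov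
equation gives arbitrarily large supersolutions (`exists_supersolution`), and the flow from a
supersolution decreases to an equilibrium `P`. The flow from `θP`, `0 < θ ≤ 1`, increases to an
equilibrium between `θP` and `P`, which is `P` by observability (`eq_of_ric_eq_zero`). A positive
definite start below the supersolution lies above some `θP`, so it is squeezed to `P`. A
supersolution above two given starts shows that the limit is the same for both.

The spectral gap kills the lower left block of the transition matrix between two ordered Jordan
bases (`intertwiner_eq_zero`). Hence all points of the stable set span the same subspace, and `U₁ =
U₂ O` with `O` orthogonal. The filter equations are equivariant under `O` (`IsFilterSolution.conj`),
so the limits are conjugate by `O` and the lifted covariances coincide. -/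

namespace LRKB

/-! ### Uniqueness for autonomous equations and existence for linear ones. -/

section ODE

variable {E : Type*} [NormedAddCommGroup E] [NormedSpace ℝ E]

/-- Two solutions on `[0, ∞)` of an autonomous equation with a `C¹` right-hand side agree if they
have the same initial value. -/
theorem eqOn_Ici_of_hasDerivWithinAt [FiniteDimensional ℝ E] {v : E → E} (hv : ContDiff ℝ 1 v)
    {f g : ℝ → E} (hf : ∀ t, 0 ≤ t → HasDerivWithinAt f (v (f t)) (Set.Ici 0) t)
    (hg : ∀ t, 0 ≤ t → HasDerivWithinAt g (v (g t)) (Set.Ici 0) t) (h0 : f 0 = g 0) :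
    ∀ t, 0 ≤ t → f t = g t := by
  intro T hT
  have hfc : ContinuousOn f (Set.Icc 0 T) := fun t ht =>
    ((hf t ht.1).continuousWithinAt).mono Set.Icc_subset_Ici_self
  have hgc : ContinuousOn g (Set.Icc 0 T) := fun t ht =>
    ((hg t ht.1).continuousWithinAt).mono Set.Icc_subset_Ici_self
  -- A `C¹` field is only locally Lipschitz, so both trajectories on `[0, T]` are first confined to
  -- one ball.
  obtain ⟨r, hr⟩ := ((isCompact_Icc.image_of_continuousOn hfc).isBounded.union
    (isCompact_Icc.image_of_continuousOn hgc).isBounded).subset_closedBall 0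
  obtain ⟨K, hK⟩ := (hv.contDiffOn (s := Metric.closedBall 0 r)).exists_lipschitzOnWith
    one_ne_zero (convex_closedBall 0 r) (isCompact_closedBall 0 r)
  refine ODE_solution_unique_of_mem_Icc_right (v := fun _ => v)
    (s := fun _ => Metric.closedBall 0 r) (fun _ _ => hK) hfc
    (fun t ht => (hf t ht.1).mono (Set.Ici_subset_Ici.2 ht.1)) ?_ hgc
    (fun t ht => (hg t ht.1).mono (Set.Ici_subset_Ici.2 ht.1)) ?_ h0 (Set.right_mem_Icc.2 hT)
  · exact fun t ht => hr (Or.inl ⟨t, ⟨ht.1, ht.2.le⟩, rfl⟩)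
  · exact fun t ht => hr (Or.inr ⟨t, ⟨ht.1, ht.2.le⟩, rfl⟩)

theorem exists_forall_hasDerivAt_linear [CompleteSpace E] (L : E →L[ℝ] E) (z₀ : E) :
    ∃ z : ℝ → E, z 0 = z₀ ∧ ∀ t, HasDerivAt z (L (z t)) t := by
  refine ⟨fun t => NormedSpace.exp (t • L) z₀, by simp, fun t => ?_⟩
  have h := (hasDerivAt_exp_smul_const' (𝕂 := ℝ) L t).clm_apply (hasDerivAt_const t z₀)
  simpa using h

end ODE

/-! ### Entrywise differentiation of matrix functions. -/

section MatrixCalculus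

open Matrix

variable {ι : Type*} {M N : ℝ → Matrix ι ι ℝ} {M' N' : Matrix ι ι ℝ} {t : ℝ}

theorem hasDerivAt_matrix [Fintype ι] :
    HasDerivAt M M' t ↔ ∀ i j, HasDerivAt (fun s => M s i j) (M' i j) t :=
  (hasDerivAt_pi (φ := fun s i j => M s i j) (φ' := fun i j => M' i j)).trans
    (forall_congr' fun _ => hasDerivAt_pi)

variable [Fintype ι]

theorem hasDerivAt_matrix_sub (hM : HasDerivAt M M' t) (hN : HasDerivAt N N' t) :
    HasDerivAt (fun s => M s - N s) (M' - N') t :=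
  hasDerivAt_matrix.2 fun i j => (hasDerivAt_matrix.1 hM i j).sub (hasDerivAt_matrix.1 hN i j)

theorem hasDerivAt_matrix_const (P : Matrix ι ι ℝ) (t : ℝ) :
    HasDerivAt (fun _ : ℝ => P) 0 t :=
  hasDerivAt_matrix.2 fun i j => hasDerivAt_const t (P i j)

theorem hasDerivAt_transpose (h : HasDerivAt M M' t) : HasDerivAt (fun s => (M s)ᵀ) M'ᵀ t :=
  hasDerivAt_matrix.2 fun i j => hasDerivAt_matrix.1 h j i

theorem hasDerivAt_matrix_mul (hM : HasDerivAt M M' t) (hN : HasDerivAt N N' t) :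
    HasDerivAt (fun s => M s * N s) (M' * N t + M t * N') t := by
  refine hasDerivAt_matrix.2 fun i j => ?_
  simp only [Matrix.mul_apply, Matrix.add_apply, ← Finset.sum_add_distrib]
  exact HasDerivAt.fun_sum fun k _ =>
    (hasDerivAt_matrix.1 hM i k).mul (hasDerivAt_matrix.1 hN k j)

variable [DecidableEq ι]

attribute [local instance] Matrix.linftyOpNormedRing Matrix.linftyOpNormedAlgebra in
theorem hasDerivAt_matrix_inv (h : HasDerivAt M M' t) (hM : IsUnit (M t)) :
    HasDerivAt (fun s => (M s)⁻¹) (-((M t)⁻¹ * M' * (M t)⁻¹)) t := by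
  obtain ⟨u, hu⟩ := hM
  have h1 := hasFDerivAt_ringInverse (𝕜 := ℝ) u
  rw [hu] at h1
  have h2 := h1.comp_hasDerivAt t h
  simp only [Function.comp_def, ← Matrix.nonsing_inv_eq_ringInverse] at h2
  simp [← hu, Matrix.coe_units_inv] at h2 ⊢
  exact h2

end MatrixCalculus
-- Real positive semidefinite matrices and limits in the Loewner order.
section PosSemidef

open Matrix

variable {ι : Type*} [Fintype ι]

theorem posSemidef_real_iff {M : Matrix ι ι ℝ} :
    M.PosSemidef ↔ Mᵀ = M ∧ ∀ x, 0 ≤ x ⬝ᵥ M *ᵥ x := by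
  rw [posSemidef_iff_dotProduct_mulVec]
  simp [IsHermitian]

theorem posDef_real_iff {M : Matrix ι ι ℝ} :
    M.PosDef ↔ Mᵀ = M ∧ ∀ x, x ≠ 0 → 0 < x ⬝ᵥ M *ᵥ x := by
  rw [posDef_iff_dotProduct_mulVec]
  simp [IsHermitian]

theorem PosSemidef.transpose_eq {M : Matrix ι ι ℝ} (h : M.PosSemidef) : Mᵀ = M :=
  (posSemidef_real_iff.1 h).1

theorem posSemidef_transpose_mul_mul {κ : Type*} [Fintype κ] {M : Matrix ι ι ℝ}
    (h : M.PosSemidef) (B : Matrix ι κ ℝ) : (Bᵀ * M * B).PosSemidef := by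
  simpa using h.conjTranspose_mul_mul_same B

theorem posSemidef_mulVec_eq_zero_iff {M : Matrix ι ι ℝ} (h : M.PosSemidef) (x : ι → ℝ) :
    x ⬝ᵥ M *ᵥ x = 0 ↔ M *ᵥ x = 0 := by
  simpa using h.dotProduct_mulVec_zero_iff x

/-- The entries of a symmetric matrix in terms of its quadratic form. -/
theorem symm_apply_eq_polarization [DecidableEq ι] {M : Matrix ι ι ℝ} (h : Mᵀ = M) (i j : ι) :
    M i j = ((Pi.single i 1 + Pi.single j 1) ⬝ᵥ M *ᵥ (Pi.single i 1 + Pi.single j 1)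
      - (Pi.single i 1) ⬝ᵥ M *ᵥ (Pi.single i 1) - (Pi.single j 1) ⬝ᵥ M *ᵥ (Pi.single j 1)) / 2 := by
  have : M j i = M i j := by conv_rhs => rw [← h, transpose_apply]
  simp [mulVec_add, this]
  ring

theorem continuous_quadraticForm (x : ι → ℝ) :
    Continuous fun M : Matrix ι ι ℝ => x ⬝ᵥ M *ᵥ x := by
  fun_prop

theorem tendsto_matrix_of_tendsto_quadraticForm {R : ℝ → Matrix ι ι ℝ} {P : Matrix ι ι ℝ}
    (hR : ∀ t, 0 ≤ t → (R t)ᵀ = R t) (hP : Pᵀ = P)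
    (h : ∀ x, Tendsto (fun t => x ⬝ᵥ R t *ᵥ x) atTop (𝓝 (x ⬝ᵥ P *ᵥ x))) :
    Tendsto R atTop (𝓝 P) := by
  classical
  refine tendsto_pi_nhds.2 fun i => tendsto_pi_nhds.2 fun j => ?_
  rw [symm_apply_eq_polarization hP i j]
  refine Tendsto.congr' ?_ ((((h _).sub (h _)).sub (h _)).div_const 2)
  filter_upwards [eventually_ge_atTop 0] with t ht
  exact (symm_apply_eq_polarization (hR t ht) i j).symm

theorem posSemidef_of_tendsto {R : ℝ → Matrix ι ι ℝ} {P : Matrix ι ι ℝ}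
    (h : Tendsto R atTop (𝓝 P)) (hR : ∀ t, 0 ≤ t → (R t).PosSemidef) : P.PosSemidef := by
  refine posSemidef_real_iff.2 ⟨?_, fun x => ?_⟩
  · have h1 : Tendsto (fun t => (R t)ᵀ) atTop (𝓝 Pᵀ) :=
      (continuous_id.matrix_transpose.tendsto P).comp h
    refine tendsto_nhds_unique (h1.congr' ?_) h
    filter_upwards [eventually_ge_atTop 0] with t ht using PosSemidef.transpose_eq (hR t ht)
  · refine ge_of_tendsto (((continuous_quadraticForm x).tendsto P).comp h) ?_
    filter_upwards [eventually_ge_atTop 0] with t ht using (posSemidef_real_iff.1 (hR t ht)).2 x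

/-- Each quadratic form `x ⬝ᵥ R t *ᵥ x` is a bounded monotone real function; polarization assembles
the scalar limits into a matrix. -/
theorem exists_tendsto_of_monotone {R : ℝ → Matrix ι ι ℝ} {P : Matrix ι ι ℝ}
    (hR : ∀ t, 0 ≤ t → (R t)ᵀ = R t) (hmono : ∀ s t, 0 ≤ s → s ≤ t → (R t - R s).PosSemidef)
    (hP : ∀ t, 0 ≤ t → (P - R t).PosSemidef) : ∃ L, Tendsto R atTop (𝓝 L) := by
  classical
  have key : ∀ x, ∃ l, Tendsto (fun t => x ⬝ᵥ R t *ᵥ x) atTop (𝓝 l) := by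
    intro x
    -- Freezing time at `max t 0` gives a function that is monotone on the whole line.
    have hm : Monotone fun t => x ⬝ᵥ R (max t 0) *ᵥ x := fun s t hst => by
      have := (posSemidef_real_iff.1
        (hmono (max s 0) (max t 0) (le_max_right _ _) (max_le_max_right 0 hst))).2 x
      rw [sub_mulVec, dotProduct_sub] at this
      exact sub_nonneg.1 this
    have hb : BddAbove (Set.range fun t => x ⬝ᵥ R (max t 0) *ᵥ x) := by
      refine ⟨x ⬝ᵥ P *ᵥ x, ?_⟩
      rintro _ ⟨t, rfl⟩
      have := (posSemidef_real_iff.1 (hP (max t 0) (le_max_right _ _))).2 x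
      rw [sub_mulVec, dotProduct_sub] at this
      exact sub_nonneg.1 this
    refine ⟨_, (tendsto_atTop_ciSup hm hb).congr' ?_⟩
    filter_upwards [eventually_ge_atTop 0] with t ht
    rw [max_eq_left ht]
  choose l hl using key
  refine ⟨Matrix.of fun i j => (l (Pi.single i 1 + Pi.single j 1) - l (Pi.single i 1)
    - l (Pi.single j 1)) / 2, ?_⟩
  refine tendsto_pi_nhds.2 fun i => tendsto_pi_nhds.2 fun j => ?_
  refine Tendsto.congr' ?_ ((((hl _).sub (hl _)).sub (hl _)).div_const 2)
  filter_upwards [eventually_ge_atTop 0] with t ht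
  exact (symm_apply_eq_polarization (hR t ht) i j).symm

theorem tendsto_of_sandwich {L R B : ℝ → Matrix ι ι ℝ} {P : Matrix ι ι ℝ}
    (hP : Pᵀ = P) (hR : ∀ t, 0 ≤ t → (R t)ᵀ = R t)
    (hLR : ∀ t, 0 ≤ t → (R t - L t).PosSemidef) (hRB : ∀ t, 0 ≤ t → (B t - R t).PosSemidef)
    (hL : Tendsto L atTop (𝓝 P)) (hB : Tendsto B atTop (𝓝 P)) : Tendsto R atTop (𝓝 P) := by
  refine tendsto_matrix_of_tendsto_quadraticForm hR hP fun x => ?_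
  refine tendsto_of_tendsto_of_tendsto_of_le_of_le'
    (((continuous_quadraticForm x).tendsto P).comp hL)
    (((continuous_quadraticForm x).tendsto P).comp hB) ?_ ?_
  · filter_upwards [eventually_ge_atTop 0] with t ht
    have := (posSemidef_real_iff.1 (hLR t ht)).2 x
    rw [sub_mulVec, dotProduct_sub] at this
    exact sub_nonneg.1 this
  · filter_upwards [eventually_ge_atTop 0] with t ht
    have := (posSemidef_real_iff.1 (hRB t ht)).2 x
    rw [sub_mulVec, dotProduct_sub] at this
    exact sub_nonneg.1 this

theorem hasDerivAt_quadraticForm {M : ℝ → Matrix ι ι ℝ} {M' : Matrix ι ι ℝ} {t : ℝ}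
    (h : HasDerivAt M M' t) (x : ι → ℝ) :
    HasDerivAt (fun s => x ⬝ᵥ M s *ᵥ x) (x ⬝ᵥ M' *ᵥ x) t := by
  simp only [dotProduct, mulVec]
  exact HasDerivAt.fun_sum fun i _ => (HasDerivAt.fun_sum fun j _ =>
    (hasDerivAt_matrix.1 h i j).mul_const _).const_mul _

theorem monotoneOn_Ici_of_hasDerivAt_nonneg {f f' : ℝ → ℝ} (hf : ∀ t, 0 ≤ t → HasDerivAt f (f' t) t)
    (h : ∀ t, 0 ≤ t → 0 ≤ f' t) : MonotoneOn f (Set.Ici 0) := by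
  refine monotoneOn_of_hasDerivWithinAt_nonneg (convex_Ici 0)
    (fun t ht => (hf t ht).continuousAt.continuousWithinAt)
    (fun t ht => (hf t (interior_subset ht)).hasDerivWithinAt)
    (fun t ht => h t (interior_subset ht))

/-- A matrix function whose derivative is positive semidefinite is increasing in the Loewner
order. -/
theorem posSemidef_sub_of_hasDerivAt {M M' : ℝ → Matrix ι ι ℝ}
    (hM : ∀ t, 0 ≤ t → HasDerivAt M (M' t) t) (h : ∀ t, 0 ≤ t → (M' t).PosSemidef)
    (h0 : (M 0)ᵀ = M 0) (hs : ∀ t, 0 ≤ t → (M t)ᵀ = M t) {t : ℝ} (ht : 0 ≤ t) :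
    (M t - M 0).PosSemidef := by
  refine posSemidef_real_iff.2 ⟨by rw [transpose_sub, hs t ht, h0], fun x => ?_⟩
  rw [sub_mulVec, dotProduct_sub, sub_nonneg]
  exact monotoneOn_Ici_of_hasDerivAt_nonneg (fun t ht => hasDerivAt_quadraticForm (hM t ht) x)
    (fun t ht => (posSemidef_real_iff.1 (h t ht)).2 x) Set.self_mem_Ici ht ht

theorem transpose_eq_of_hasDerivAt {M M' : ℝ → Matrix ι ι ℝ}
    (hM : ∀ t, HasDerivAt M (M' t) t) (h : ∀ t, (M' t)ᵀ = M' t)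
    (h0 : (M 0)ᵀ = M 0) (t : ℝ) : (M t)ᵀ = M t := by
  ext i j
  have hd : ∀ t, HasDerivAt (fun s => M s j i - M s i j) 0 t := fun t => by
    have h1 := (hasDerivAt_matrix.1 (hM t) j i).sub (hasDerivAt_matrix.1 (hM t) i j)
    have h2 : M' t j i = M' t i j := by conv_rhs => rw [← h t, transpose_apply]
    rw [h2, sub_self] at h1
    exact h1
  have h3 := is_const_of_deriv_eq_zero (fun t => (hd t).differentiableAt) (fun t => (hd t).deriv)
    t 0
  have h4 : M 0 j i = M 0 i j := by conv_rhs => rw [← h0, transpose_apply]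
  simp only [h4, sub_self, sub_eq_zero] at h3
  simpa using h3

open scoped MatrixOrder in
theorem exists_eq_transpose_mul_self {M : Matrix ι ι ℝ} (h : M.PosSemidef) :
    ∃ B : Matrix ι ι ℝ, M = Bᵀ * B := by
  classical
  obtain ⟨B, hB⟩ := CStarAlgebra.nonneg_iff_eq_star_mul_self.1 h.nonneg
  exact ⟨B, by simpa [star_eq_conjTranspose] using hB⟩

theorem dotProduct_transpose_mul_self_mulVec {κ : Type*} [Fintype κ] (B : Matrix κ ι ℝ)
    (x : ι → ℝ) : x ⬝ᵥ (Bᵀ * B) *ᵥ x = (B *ᵥ x) ⬝ᵥ (B *ᵥ x) := by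
  rw [← mulVec_mulVec, dotProduct_mulVec, vecMul_transpose]

/-- If `ker B ⊆ ker D`, then `D` is bounded relative to `B`. -/
theorem exists_dotProduct_mulVec_le {B D : Matrix ι ι ℝ} (h : ∀ x, B *ᵥ x = 0 → D *ᵥ x = 0) :
    ∃ c : ℝ, 0 < c ∧ ∀ x, (D *ᵥ x) ⬝ᵥ (D *ᵥ x) ≤ c * ((B *ᵥ x) ⬝ᵥ (B *ᵥ x)) := by
  classical
  -- With `g` a linear section of `B` onto its range, `x - g (B x)` lies in `ker B ⊆ ker D`; so `D =
  -- (D ∘ g) ∘ B` and the operator norm of `D ∘ g` bounds `D`.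
  obtain ⟨g, hg⟩ := LinearMap.exists_rightInverse_of_surjective B.mulVecLin.rangeRestrict
    (LinearMap.range_eq_top.2 B.mulVecLin.surjective_rangeRestrict)
  set K := LinearMap.toContinuousLinearMap (D.mulVecLin ∘ₗ g) with hK
  have hDK : ∀ x, D *ᵥ x = K (B.mulVecLin.rangeRestrict x) := by
    intro x
    have h1 : B *ᵥ (x - g (B.mulVecLin.rangeRestrict x)) = 0 := by
      have := congrArg Subtype.val (LinearMap.congr_fun hg (B.mulVecLin.rangeRestrict x))
      simp only [LinearMap.comp_apply, LinearMap.id_apply, LinearMap.codRestrict_apply,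
        LinearMap.rangeRestrict, mulVecLin_apply] at this ⊢
      rw [mulVec_sub, sub_eq_zero, this]
    have h2 := h _ h1
    rw [mulVec_sub, sub_eq_zero] at h2
    exact h2
  -- The norm on `ι → ℝ` is the sup norm, hence the comparison with the dot product in both
  -- directions.
  have hle : ∀ v : ι → ℝ, v ⬝ᵥ v ≤ Fintype.card ι * ‖v‖ ^ 2 := by
    intro v
    rw [dotProduct, ← nsmul_eq_mul]
    refine Finset.sum_le_card_nsmul _ _ _ fun i _ => ?_
    rw [← sq, ← sq_abs, ← Real.norm_eq_abs]
    gcongr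
    exact norm_le_pi_norm v i
  have hge : ∀ v : ι → ℝ, ‖v‖ ^ 2 ≤ v ⬝ᵥ v := by
    intro v
    have h0 : 0 ≤ v ⬝ᵥ v := Finset.sum_nonneg fun i _ => mul_self_nonneg (v i)
    rw [← Real.le_sqrt (norm_nonneg v) h0, pi_norm_le_iff_of_nonneg (Real.sqrt_nonneg _)]
    intro i
    rw [Real.norm_eq_abs, ← Real.sqrt_sq_eq_abs]
    refine Real.sqrt_le_sqrt ?_
    rw [sq]
    exact Finset.single_le_sum (f := fun i => v i * v i) (fun i _ => mul_self_nonneg (v i))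
      (Finset.mem_univ i)
  refine ⟨Fintype.card ι * ‖K‖ ^ 2 + 1, by positivity, fun x => ?_⟩
  have h3 := hge (B *ᵥ x)
  have h4 : ‖D *ᵥ x‖ ≤ ‖K‖ * ‖B *ᵥ x‖ := by
    rw [hDK]
    exact K.le_opNorm _
  calc (D *ᵥ x) ⬝ᵥ (D *ᵥ x) ≤ Fintype.card ι * ‖D *ᵥ x‖ ^ 2 := hle _
    _ ≤ Fintype.card ι * (‖K‖ * ‖B *ᵥ x‖) ^ 2 := by gcongr
    _ = Fintype.card ι * ‖K‖ ^ 2 * ‖B *ᵥ x‖ ^ 2 := by ring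
    _ ≤ (Fintype.card ι * ‖K‖ ^ 2 + 1) * ‖B *ᵥ x‖ ^ 2 := by gcongr; linarith
    _ ≤ _ := by gcongr

/-- If `ker Z ⊆ ker N`, the positive semidefinite `Z` dominates a positive multiple of `N`. -/
theorem exists_posSemidef_sub_smul {Z N : Matrix ι ι ℝ} (hZ : Z.PosSemidef) (hN : N.PosSemidef)
    (h : ∀ x, Z *ᵥ x = 0 → N *ᵥ x = 0) :
    ∃ δ : ℝ, 0 < δ ∧ (Z - δ • N).PosSemidef := by
  have hZs := PosSemidef.transpose_eq hZ
  have hNs := PosSemidef.transpose_eq hN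
  obtain ⟨B, hB⟩ := exists_eq_transpose_mul_self hZ
  obtain ⟨D, hD⟩ := exists_eq_transpose_mul_self hN
  obtain ⟨c, hc, hcD⟩ := exists_dotProduct_mulVec_le (B := B) (D := D) fun x hx => by
    have h1 : N *ᵥ x = 0 := h x (by rw [hB, ← mulVec_mulVec, hx, mulVec_zero])
    have h2 := dotProduct_transpose_mul_self_mulVec D x
    rw [← hD, h1, dotProduct_zero] at h2
    exact dotProduct_self_eq_zero.1 h2.symm
  refine ⟨c⁻¹, inv_pos.2 hc, posSemidef_real_iff.2 ⟨by simp [hZs, hNs], fun x => ?_⟩⟩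
  rw [sub_mulVec, smul_mulVec, dotProduct_sub, dotProduct_smul, hB, hD,
    dotProduct_transpose_mul_self_mulVec, dotProduct_transpose_mul_self_mulVec, smul_eq_mul,
    sub_nonneg, inv_mul_le_iff₀ hc]
  exact hcD x

theorem PosDef.mulVec_eq_zero {M : Matrix ι ι ℝ} (h : M.PosDef) {x : ι → ℝ} (hx : M *ᵥ x = 0) :
    x = 0 := by
  by_contra h0
  have := (posDef_real_iff.1 h).2 x h0
  rw [hx, dotProduct_zero] at this
  exact lt_irrefl _ this

end PosSemidef
-- The Riccati flow: global existence and comparison.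
section Riccati

open Matrix

variable {ι : Type*} [Fintype ι]

section LinearSystems

open scoped Matrix.Norms.Elementwise

/-- Solvability of a linear equation for a pair of square matrices. -/
theorem exists_forall_hasDerivAt_linear_pair
    (L : Matrix ι ι ℝ × Matrix ι ι ℝ →ₗ[ℝ] Matrix ι ι ℝ × Matrix ι ι ℝ) (X₀ Y₀ : Matrix ι ι ℝ) :
    ∃ X Y : ℝ → Matrix ι ι ℝ, X 0 = X₀ ∧ Y 0 = Y₀ ∧
      ∀ t, HasDerivAt X (L (X t, Y t)).1 t ∧ HasDerivAt Y (L (X t, Y t)).2 t := by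
  obtain ⟨z, hz0, hz⟩ := exists_forall_hasDerivAt_linear L.toContinuousLinearMap (X₀, Y₀)
  refine ⟨fun t => (z t).1, fun t => (z t).2, by simp [hz0], by simp [hz0], fun t => ⟨?_, ?_⟩⟩
  · exact (ContinuousLinearMap.fst ℝ (Matrix ι ι ℝ) (Matrix ι ι ℝ)).hasFDerivAt.comp_hasDerivAt t
      (hz t)
  · exact (ContinuousLinearMap.snd ℝ (Matrix ι ι ℝ) (Matrix ι ι ℝ)).hasFDerivAt.comp_hasDerivAt t
      (hz t)

end LinearSystems

theorem mulVec_eq_of_hasDerivAt_mulVec_eq_zero {M M' : ℝ → Matrix ι ι ℝ} {v : ι → ℝ} {T : ℝ}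
    (hT : 0 ≤ T)
    (hM : ∀ t, HasDerivAt M (M' t) t) (h : ∀ t, 0 ≤ t → t < T → M' t *ᵥ v = 0) :
    M T *ᵥ v = M 0 *ᵥ v := by
  ext i
  have hd : ∀ t, HasDerivAt (fun s => (M s *ᵥ v) i) ((M' t *ᵥ v) i) t := fun t => by
    simp only [mulVec, dotProduct]
    exact HasDerivAt.fun_sum fun j _ => (hasDerivAt_matrix.1 (hM t) i j).mul_const _
  refine constant_of_has_deriv_right_zero (f := fun s => (M s *ᵥ v) i) (a := 0) (b := T)
    (fun t _ => (hd t).continuousAt.continuousWithinAt) (fun t ht => ?_) T ⟨hT, le_rfl⟩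
  have := (hd t).hasDerivWithinAt (s := Set.Ici t)
  rwa [h t ht.1 ht.2] at this

variable [DecidableEq ι]

/-- Fundamental matrix of a linear equation with constant coefficients, together with its
inverse. -/
theorem exists_fundamental_matrix (B : Matrix ι ι ℝ) :
    ∃ X Z : ℝ → Matrix ι ι ℝ, X 0 = 1 ∧ Z 0 = 1 ∧ (∀ t, HasDerivAt X (B * X t) t) ∧
      (∀ t, HasDerivAt Z (-(Z t * B)) t) ∧ ∀ t, 0 ≤ t → IsUnit (X t) := by
  obtain ⟨X, Z, hX0, hZ0, h⟩ := exists_forall_hasDerivAt_linear_pair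
    (((LinearMap.mulLeft ℝ B).prodMap (-(LinearMap.mulRight ℝ B)))) 1 1
  have hX : ∀ t, HasDerivAt X (B * X t) t := fun t => (h t).1
  have hZ : ∀ t, HasDerivAt Z (-(Z t * B)) t := fun t => (h t).2
  refine ⟨X, Z, hX0, hZ0, hX, hZ, fun t ht => ?_⟩
  -- `Z X` has zero derivative and starts at the identity, so `Z` is the inverse of `X`.
  have h1 : ∀ v, (Z t * X t) *ᵥ v = (Z 0 * X 0) *ᵥ v := fun v =>
    mulVec_eq_of_hasDerivAt_mulVec_eq_zero (M := fun s => Z s * X s) ht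
      (fun s => hasDerivAt_matrix_mul (hZ s) (hX s)) fun s _ _ => by
        rw [show -(Z s * B) * X s + Z s * (B * X s) = 0 by noncomm_ring, zero_mulVec]
  have h2 : Z t * X t = 1 := by
    refine ext_of_mulVec_single fun i => ?_
    rw [h1, hX0, hZ0, one_mul]
  exact (isUnit_iff_isUnit_det _).2 (isUnit_det_of_left_inverse h2)

omit [DecidableEq ι] in
/-- The right-hand side `a R + R aᵀ + Q - R S R` of a Riccati equation. -/
def ric (a Q S R : Matrix ι ι ℝ) : Matrix ι ι ℝ := a * R + R * aᵀ + Q - R * S * R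

/-- `R` is a positive semidefinite solution of the Riccati equation on `[0, ∞)`, and `X` is a
fundamental matrix of the associated linear equation `X' = (-aᵀ + S R) X`. -/
structure IsRiccatiFlow (a Q S : Matrix ι ι ℝ) (R X : ℝ → Matrix ι ι ℝ) : Prop where
  posSemidef : ∀ t, 0 ≤ t → (R t).PosSemidef
  hasDerivAt : ∀ t, 0 ≤ t → HasDerivAt R (ric a Q S (R t)) t
  hasDerivAt_frame : ∀ t, 0 ≤ t → HasDerivAt X ((-aᵀ + S * R t) * X t) t
  isUnit_frame : ∀ t, 0 ≤ t → IsUnit (X t)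

theorem IsRiccatiFlow.shift {a Q S : Matrix ι ι ℝ} {R X : ℝ → Matrix ι ι ℝ}
    (h : IsRiccatiFlow a Q S R X) {s : ℝ} (hs : 0 ≤ s) :
    IsRiccatiFlow a Q S (fun t => R (t + s)) (fun t => X (t + s)) where
  posSemidef _ ht := h.posSemidef _ (add_nonneg ht hs)
  hasDerivAt t ht := hasDerivAt_matrix.2 fun i j =>
    (hasDerivAt_matrix.1 (h.hasDerivAt _ (add_nonneg ht hs)) i j).comp_add_const t s
  hasDerivAt_frame t ht := hasDerivAt_matrix.2 fun i j =>
    (hasDerivAt_matrix.1 (h.hasDerivAt_frame _ (add_nonneg ht hs)) i j).comp_add_const t s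
  isUnit_frame _ ht := h.isUnit_frame _ (add_nonneg ht hs)

/-- Global existence for the Riccati equation with positive semidefinite initial value. -/
theorem exists_isRiccatiFlow {a Q S R₀ : Matrix ι ι ℝ} (hQ : Q.PosSemidef) (hS : S.PosSemidef)
    (hR₀ : R₀.PosSemidef) : ∃ R X, R 0 = R₀ ∧ IsRiccatiFlow a Q S R X := by
  -- The Riccati equation is linearized by the Hamiltonian system `X' = -aᵀX + SY`, `Y' = QX + aY`:
  -- its solution is `Y X⁻¹`, and blow-up could come only from a singular `X`.
  obtain ⟨X, Y, hX0, hY0, h⟩ := exists_forall_hasDerivAt_linear_pair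
    (((-(LinearMap.mulLeft ℝ aᵀ)).coprod (LinearMap.mulLeft ℝ S)).prod
      ((LinearMap.mulLeft ℝ Q).coprod (LinearMap.mulLeft ℝ a))) 1 R₀
  have hX : ∀ t, HasDerivAt X (-(aᵀ * X t) + S * Y t) t := fun t => (h t).1
  have hY : ∀ t, HasDerivAt Y (Q * X t + a * Y t) t := fun t => (h t).2
  have hSs := PosSemidef.transpose_eq hS
  have hM : ∀ t, HasDerivAt (fun s => (X s)ᵀ * Y s)
      ((Y t)ᵀ * S * Y t + (X t)ᵀ * Q * X t) t := fun t => by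
    convert hasDerivAt_matrix_mul (hasDerivAt_transpose (hX t)) (hY t) using 1
    simp only [transpose_add, transpose_neg, transpose_mul, transpose_transpose, hSs]
    noncomm_ring
  have hM' : ∀ t, ((Y t)ᵀ * S * Y t + (X t)ᵀ * Q * X t).PosSemidef := fun t =>
    (posSemidef_transpose_mul_mul hS _).add (posSemidef_transpose_mul_mul hQ _)
  have hM0 : (X 0)ᵀ * Y 0 = R₀ := by simp [hX0, hY0]
  have hMs : ∀ t, ((X t)ᵀ * Y t)ᵀ = (X t)ᵀ * Y t :=
    transpose_eq_of_hasDerivAt hM (fun t => PosSemidef.transpose_eq (hM' t))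
      (by rw [hM0, PosSemidef.transpose_eq hR₀])
  have hMp : ∀ t, 0 ≤ t → ((X t)ᵀ * Y t).PosSemidef := fun t ht => by
    have := (posSemidef_sub_of_hasDerivAt (fun t _ => hM t) (fun t _ => hM' t) (hMs 0)
      (fun t _ => hMs t) ht).add hR₀
    rwa [hM0, sub_add_cancel] at this
  -- If `X T v = 0`, the nonnegative increasing function `vᵀ XᵀY v` vanishes at `T`, hence on `[0,
  -- T]`. Its derivative then gives `S Y v = 0` before `T`, so `X v` solves `x' = -aᵀx` there;
  -- vanishing at `T`, it vanishes at `0`, where it equals `v`.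
  have hXu : ∀ t, 0 ≤ t → IsUnit (X t) := by
    intro T hT
    rw [← mulVec_injective_iff_isUnit, ← coe_mulVecLin, injective_iff_map_eq_zero]
    intro v hv
    rw [mulVecLin_apply] at hv
    have hφ : ∀ t, HasDerivAt (fun s => v ⬝ᵥ ((X s)ᵀ * Y s) *ᵥ v)
      (v ⬝ᵥ ((Y t)ᵀ * S * Y t + (X t)ᵀ * Q * X t) *ᵥ v) t := fun t =>
        hasDerivAt_quadraticForm (hM t) v
    have hmono := monotoneOn_Ici_of_hasDerivAt_nonneg (fun t _ => hφ t)
      (fun t _ => (posSemidef_real_iff.1 (hM' t)).2 v)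
    have hT0 : v ⬝ᵥ ((X T)ᵀ * Y T) *ᵥ v = 0 := by
      rw [← mulVec_mulVec, dotProduct_mulVec, vecMul_transpose, hv, zero_dotProduct]
    have hzero : ∀ t, 0 ≤ t → t ≤ T → v ⬝ᵥ ((X t)ᵀ * Y t) *ᵥ v = 0 := fun t h0 h1 =>
      le_antisymm (hT0 ▸ hmono h0 hT h1) ((posSemidef_real_iff.1 (hMp t h0)).2 v)
    have hSY : ∀ t, 0 ≤ t → t < T → (S * Y t) *ᵥ v = 0 := by
      intro t h0 h1
      have hd : HasDerivWithinAt (fun s => v ⬝ᵥ ((X s)ᵀ * Y s) *ᵥ v) 0 (Set.Ici t) t := by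
        refine (hasDerivWithinAt_const t _ (0 : ℝ)).congr_of_eventuallyEq ?_ (hzero t h0 h1.le)
        filter_upwards [Icc_mem_nhdsGE h1] with s hs using hzero s (h0.trans hs.1) hs.2
      have h2 := (uniqueDiffWithinAt_Ici t).eq_deriv _ ((hφ t).hasDerivWithinAt) hd
      rw [add_mulVec, dotProduct_add] at h2
      have h3 := (posSemidef_real_iff.1 (posSemidef_transpose_mul_mul hS (Y t))).2 v
      have h4 := (posSemidef_real_iff.1 (posSemidef_transpose_mul_mul hQ (X t))).2 v
      have h5 : v ⬝ᵥ ((Y t)ᵀ * S * Y t) *ᵥ v = 0 := by linarith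
      rw [Matrix.mul_assoc, ← mulVec_mulVec, dotProduct_mulVec, vecMul_transpose,
        ← mulVec_mulVec, posSemidef_mulVec_eq_zero_iff hS] at h5
      rw [← mulVec_mulVec, h5]
    obtain ⟨-, Z, -, hZ0, -, hZ, -⟩ := exists_fundamental_matrix (-aᵀ)
    have h6 := mulVec_eq_of_hasDerivAt_mulVec_eq_zero (M := fun s => Z s * X s) (v := v) hT
      (fun s => hasDerivAt_matrix_mul (hZ s) (hX s)) fun s h0 h1 => by
        rw [show -(Z s * -aᵀ) * X s + Z s * (-(aᵀ * X s) + S * Y s) = Z s * (S * Y s) by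
          noncomm_ring, ← mulVec_mulVec, hSY s h0 h1, mulVec_zero]
    simpa [hZ0, hX0, ← mulVec_mulVec, hv] using h6.symm
  have hinv : ∀ t, 0 ≤ t → X t * (X t)⁻¹ = 1 := fun t ht =>
    mul_nonsing_inv _ ((isUnit_iff_isUnit_det _).1 (hXu t ht))
  have hinv' : ∀ t, 0 ≤ t → (X t)⁻¹ * X t = 1 := fun t ht =>
    nonsing_inv_mul _ ((isUnit_iff_isUnit_det _).1 (hXu t ht))
  refine ⟨fun t => Y t * (X t)⁻¹, X, by simp [hX0, hY0], fun t ht => ?_, fun t ht => ?_,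
    fun t ht => ?_, hXu⟩
  · have h1 := posSemidef_transpose_mul_mul (hMp t ht) (X t)⁻¹
    have h2 : ((X t)⁻¹)ᵀ * ((X t)ᵀ * Y t) * (X t)⁻¹ = Y t * (X t)⁻¹ := by
      rw [← Matrix.mul_assoc, ← transpose_mul, hinv t ht, transpose_one, Matrix.one_mul]
    rwa [h2] at h1
  · convert hasDerivAt_matrix_mul (hY t) (hasDerivAt_matrix_inv (hX t) (hXu t ht)) using 1
    rw [ric]
    have h1 : (Q * X t + a * Y t) * (X t)⁻¹ = Q * (X t * (X t)⁻¹) + a * (Y t * (X t)⁻¹) := by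
      noncomm_ring
    have h2 : Y t * -((X t)⁻¹ * (-(aᵀ * X t) + S * Y t) * (X t)⁻¹) =
        Y t * (X t)⁻¹ * aᵀ * (X t * (X t)⁻¹) - Y t * (X t)⁻¹ * S * (Y t * (X t)⁻¹) := by
      noncomm_ring
    rw [h1, h2, hinv t ht]
    noncomm_ring
  · convert hX t using 1
    rw [show (-aᵀ + S * (Y t * (X t)⁻¹)) * X t = -(aᵀ * X t) + S * Y t * ((X t)⁻¹ * X t) by
      noncomm_ring, hinv' t ht, Matrix.mul_one]

/-- Comparison for the Riccati equation. -/
theorem posSemidef_sub_of_riccati {a Q S : Matrix ι ι ℝ} (hS : S.PosSemidef)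
    {R₁ R₂ R₁' R₂' X : ℝ → Matrix ι ι ℝ}
    (h₁ : ∀ t, 0 ≤ t → HasDerivAt R₁ (R₁' t) t) (h₂ : ∀ t, 0 ≤ t → HasDerivAt R₂ (R₂' t) t)
    (hs₁ : ∀ t, 0 ≤ t → (R₁ t)ᵀ = R₁ t) (hs₂ : ∀ t, 0 ≤ t → (R₂ t)ᵀ = R₂ t)
    (hE : ∀ t, 0 ≤ t → (R₂' t - R₁' t - (ric a Q S (R₂ t) - ric a Q S (R₁ t))).PosSemidef)
    (hX : ∀ t, 0 ≤ t → HasDerivAt X ((-aᵀ + S * R₂ t) * X t) t)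
    (hXu : ∀ t, 0 ≤ t → IsUnit (X t)) (h0 : (R₂ 0 - R₁ 0).PosSemidef) {t : ℝ} (ht : 0 ≤ t) :
    (R₂ t - R₁ t).PosSemidef := by
  have hSs := PosSemidef.transpose_eq hS
  have hDs : ∀ t, 0 ≤ t → (R₂ t - R₁ t)ᵀ = R₂ t - R₁ t := fun t ht => by
    rw [transpose_sub, hs₁ t ht, hs₂ t ht]
  -- For `D = R₂ - R₁`, `ric R₂ - ric R₁ = (a - R₂S)D + D(a - R₂S)ᵀ + DSD`. Conjugation by the frame
  -- `X` cancels the linear terms and leaves a positive semidefinite derivative.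
  have hM : ∀ t, 0 ≤ t → HasDerivAt (fun s => (X s)ᵀ * (R₂ s - R₁ s) * X s)
      ((X t)ᵀ * ((R₂ t - R₁ t)ᵀ * S * (R₂ t - R₁ t) +
        (R₂' t - R₁' t - (ric a Q S (R₂ t) - ric a Q S (R₁ t)))) * X t) t := fun t ht => by
    convert hasDerivAt_matrix_mul (hasDerivAt_matrix_mul (hasDerivAt_transpose (hX t ht))
      (hasDerivAt_matrix_sub (h₂ t ht) (h₁ t ht))) (hX t ht) using 1
    simp only [transpose_mul, transpose_add, transpose_neg, transpose_transpose, hSs, hs₂ t ht,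
      hDs t ht, ric]
    noncomm_ring
  have hMs : ∀ t, 0 ≤ t → ((X t)ᵀ * (R₂ t - R₁ t) * X t)ᵀ = (X t)ᵀ * (R₂ t - R₁ t) * X t :=
    fun t ht => by
      rw [transpose_mul, transpose_mul, transpose_transpose, hDs t ht, Matrix.mul_assoc]
  have h3 := posSemidef_sub_of_hasDerivAt hM (fun t ht => posSemidef_transpose_mul_mul
    ((posSemidef_transpose_mul_mul hS _).add (hE t ht)) _) (hMs 0 le_rfl) hMs ht
  have h4 := h3.add (posSemidef_transpose_mul_mul h0 (X 0))
  rw [sub_add_cancel] at h4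
  exact (IsUnit.posSemidef_star_left_conjugate_iff (hXu t ht)).1 (by
    simpa [star_eq_conjTranspose] using h4)

end Riccati
-- Monotone Riccati flows and rigidity of equilibria.
section RiccatiLimit

open Matrix

variable {ι : Type*} [Fintype ι] [DecidableEq ι] {a Q S : Matrix ι ι ℝ}

omit [DecidableEq ι] in
theorem continuous_ric : Continuous (ric a Q S) := by
  unfold ric
  fun_prop

omit [DecidableEq ι] in
-- This makes `θP` a subsolution when `P` is a positive semidefinite equilibrium and `0 ≤ θ ≤ 1`:
-- the two remaining terms are positive semidefinite.
theorem ric_smul (θ : ℝ) (P : Matrix ι ι ℝ) :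
    ric a Q S (θ • P) = θ • ric a Q S P + (1 - θ) • Q + (θ * (1 - θ)) • (P * S * P) := by
  simp only [ric, Matrix.mul_smul, Matrix.smul_mul, smul_add, smul_sub, smul_smul, sub_smul,
    one_smul, mul_sub, mul_one]
  abel

theorem IsRiccatiFlow.transpose_eq {R X : ℝ → Matrix ι ι ℝ} (h : IsRiccatiFlow a Q S R X) (t : ℝ)
    (ht : 0 ≤ t) : (R t)ᵀ = R t :=
  PosSemidef.transpose_eq (h.posSemidef t ht)

theorem IsRiccatiFlow.mono (hS : S.PosSemidef) {R₁ R₂ X₁ X₂ : ℝ → Matrix ι ι ℝ}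
    (h₁ : IsRiccatiFlow a Q S R₁ X₁) (h₂ : IsRiccatiFlow a Q S R₂ X₂)
    (h0 : (R₂ 0 - R₁ 0).PosSemidef) (t : ℝ) (ht : 0 ≤ t) : (R₂ t - R₁ t).PosSemidef :=
  posSemidef_sub_of_riccati (a := a) (Q := Q) hS h₁.hasDerivAt h₂.hasDerivAt h₁.transpose_eq
    h₂.transpose_eq
    (fun t _ => by simpa using Matrix.PosSemidef.zero) h₂.hasDerivAt_frame h₂.isUnit_frame h0 ht

theorem IsRiccatiFlow.le_of_supersolution (hS : S.PosSemidef) {R X : ℝ → Matrix ι ι ℝ}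
    (h : IsRiccatiFlow a Q S R X) {P : Matrix ι ι ℝ} (hP : Pᵀ = P)
    (hric : (-ric a Q S P).PosSemidef) (h0 : (P - R 0).PosSemidef) (t : ℝ) (ht : 0 ≤ t) :
    (P - R t).PosSemidef := by
  obtain ⟨Y, -, -, -, hY, -, hYu⟩ := exists_fundamental_matrix (-aᵀ + S * P)
  exact posSemidef_sub_of_riccati (a := a) (Q := Q) hS (R₂ := fun _ => P) h.hasDerivAt
    (fun t _ => hasDerivAt_matrix_const P t) h.transpose_eq (fun _ _ => hP)
    (fun t _ => by
      convert hric using 1; abel) (fun t _ => hY t) hYu h0 ht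

theorem IsRiccatiFlow.ge_of_subsolution (hS : S.PosSemidef) {R X : ℝ → Matrix ι ι ℝ}
    (h : IsRiccatiFlow a Q S R X) {P : Matrix ι ι ℝ} (hP : Pᵀ = P)
    (hric : (ric a Q S P).PosSemidef) (h0 : (R 0 - P).PosSemidef) (t : ℝ) (ht : 0 ≤ t) :
    (R t - P).PosSemidef :=
  posSemidef_sub_of_riccati (a := a) (Q := Q) hS (R₁ := fun _ => P)
    (fun t _ => hasDerivAt_matrix_const P t) h.hasDerivAt (fun _ _ => hP) h.transpose_eq
    (fun t _ => by simpa using hric) h.hasDerivAt_frame h.isUnit_frame h0 ht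

/-- The flow stays below its starting supersolution, so the time-shifted flow starts below the
original one; order preservation propagates this to all later times. -/
theorem IsRiccatiFlow.antitone (hS : S.PosSemidef) {R X : ℝ → Matrix ι ι ℝ}
    (h : IsRiccatiFlow a Q S R X) (hric : (-ric a Q S (R 0)).PosSemidef) {s t : ℝ} (hs : 0 ≤ s)
    (hst : s ≤ t) : (R s - R t).PosSemidef := by
  have h1 := (h.shift (sub_nonneg.2 hst)).mono hS h (by
    simpa using h.le_of_supersolution hS (h.transpose_eq 0 le_rfl) hric 
        (by simpa using Matrix.PosSemidef.zero)
      (t - s) (sub_nonneg.2 hst)) s hs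
  simpa using h1

theorem IsRiccatiFlow.monotone (hS : S.PosSemidef) {R X : ℝ → Matrix ι ι ℝ}
    (h : IsRiccatiFlow a Q S R X) (hric : (ric a Q S (R 0)).PosSemidef) {s t : ℝ} (hs : 0 ≤ s)
    (hst : s ≤ t) : (R t - R s).PosSemidef := by
  have h1 := h.mono hS (h.shift (sub_nonneg.2 hst)) (by
    simpa using h.ge_of_subsolution hS (h.transpose_eq 0 le_rfl) hric 
        (by simpa using Matrix.PosSemidef.zero)
      (t - s) (sub_nonneg.2 hst)) s hs
  simpa using h1

/-- If a function and its derivative both converge, the derivative converges to zero. -/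
theorem eq_zero_of_tendsto_of_tendsto_deriv {g g' : ℝ → ℝ} {c l : ℝ}
    (hg : ∀ t, 0 ≤ t → HasDerivAt g (g' t) t) (hc : Tendsto g atTop (𝓝 c))
    (hl : Tendsto g' atTop (𝓝 l)) : l = 0 := by
  -- Mean value theorem on `[t, t + 1]`; for negative `t` the value `ξ = t` is a filler.
  have key : ∀ t : ℝ, ∃ ξ, t ≤ ξ ∧ (0 ≤ t → g' ξ = g (t + 1) - g t) := by
    intro t
    by_cases ht : 0 ≤ t
    · obtain ⟨ξ, hξ, h⟩ := exists_hasDerivAt_eq_slope g g' (lt_add_one t)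
        (fun s hs => (hg s (ht.trans hs.1)).continuousAt.continuousWithinAt)
        (fun s hs => hg s (ht.trans hs.1.le))
      exact ⟨ξ, hξ.1.le, fun _ => by simpa using h⟩
    · exact ⟨t, le_rfl, fun h => absurd h ht⟩
  choose ξ hξ h using key
  have h1 : Tendsto (fun t => g' (ξ t)) atTop (𝓝 l) :=
    hl.comp (tendsto_atTop_mono hξ tendsto_id)
  have h2 : Tendsto (fun t => g (t + 1) - g t) atTop (𝓝 (c - c)) :=
    (hc.comp (tendsto_atTop_add_const_right _ 1 tendsto_id)).sub hc
  rw [sub_self] at h2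
  refine tendsto_nhds_unique (h1.congr' ?_) h2
  filter_upwards [eventually_ge_atTop 0] with t ht using h t ht

theorem IsRiccatiFlow.ric_eq_zero_of_tendsto {R X : ℝ → Matrix ι ι ℝ}
    (h : IsRiccatiFlow a Q S R X) {P : Matrix ι ι ℝ} (hR : Tendsto R atTop (𝓝 P)) :
    ric a Q S P = 0 := by
  ext i j
  have hd : ∀ M : ℝ → Matrix ι ι ℝ, ∀ N : Matrix ι ι ℝ, Tendsto M atTop (𝓝 N) →
      Tendsto (fun t => M t i j) atTop (𝓝 (N i j)) := fun M N hM =>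
    tendsto_pi_nhds.1 (tendsto_pi_nhds.1 hM i) j
  exact eq_zero_of_tendsto_of_tendsto_deriv
    (fun t ht => hasDerivAt_matrix.1 (h.hasDerivAt t ht) i j) (hd _ _ hR)
    (hd _ _ ((continuous_ric.tendsto P).comp hR))

/-- An equilibrium of the Riccati equation that lies below `P` and above a positive multiple of
`P`, for another equilibrium `P`, equals `P`, provided that `(S, a)` is observable. -/
theorem eq_of_ric_eq_zero (hobs : ∀ x, (∀ k : ℕ, S *ᵥ (a ^ k *ᵥ x) = 0) → x = 0)
    (hQ : Q.PosSemidef) (hS : S.PosSemidef) {P R : Matrix ι ι ℝ} (hP : P.PosSemidef)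
    (hPric : ric a Q S P = 0) (hRric : ric a Q S R = 0)
    (hRP : (P - R).PosSemidef) {θ : ℝ} (hθ : 0 < θ) (hθ1 : θ ≤ 1)
    (hθR : (R - θ • P).PosSemidef) : R = P := by
  have hPs := PosSemidef.transpose_eq hP
  have hRs : Rᵀ = R := by
    have := PosSemidef.transpose_eq hRP
    rw [transpose_sub, hPs] at this
    exact sub_right_injective this
  -- For `x` in the kernel of `Z = R - θP`, testing the difference of the two equilibrium equations
  -- on `x` forces `Qx = 0` and `SPx = 0`. Then `ker Z` is `aᵀ`-invariant and `P aᵀ x = -a P x`, so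
  -- `S aᵏ P x = 0` for all `k`, and observability gives `Px = 0`.
  have hker : ∀ θ : ℝ, 0 < θ → θ < 1 → (R - θ • P).PosSemidef →
      ∀ x, (R - θ • P) *ᵥ x = 0 → P *ᵥ x = 0 := by
    intro θ h0 h1 hZ
    set Z := R - θ • P with hZdef
    have hR : R = Z + θ • P := by rw [hZdef, sub_add_cancel]
    have hZs := PosSemidef.transpose_eq hZ
    have hid : a * Z + Z * aᵀ + (1 - θ) • Q + (θ * (1 - θ)) • (P * S * P)
        - (Z + θ • P) * S * Z - θ • (Z * S * P) = 0 := by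
      have h2 : ric a Q S R - θ • ric a Q S P = 0 := by rw [hPric, hRric]; simp
      rw [hR] at h2
      rw [← h2]
      simp only [ric, Matrix.mul_add, Matrix.add_mul, Matrix.mul_smul, Matrix.smul_mul, smul_add,
        smul_sub, smul_smul, sub_smul, one_smul, mul_sub, mul_one]
      abel
    have hstep : ∀ x, Z *ᵥ x = 0 → S *ᵥ (P *ᵥ x) = 0 ∧ Z *ᵥ (aᵀ *ᵥ x) = 0 ∧
        P *ᵥ (aᵀ *ᵥ x) = -(a *ᵥ (P *ᵥ x)) := by
      intro x hx
      have hx1 := congrArg (fun M => M *ᵥ x) hid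
      simp only [add_mulVec, sub_mulVec, smul_mulVec, ← mulVec_mulVec, hx, mulVec_zero, zero_mulVec,
        zero_add, sub_zero] at hx1
      have hxZ : ∀ y, x ⬝ᵥ Z *ᵥ y = 0 := fun y => by
        rw [dotProduct_mulVec, ← hZs, vecMul_transpose, hx, zero_dotProduct]
      have hxP : ∀ y, x ⬝ᵥ P *ᵥ y = (P *ᵥ x) ⬝ᵥ y := fun y => by
        rw [dotProduct_mulVec]; nth_rw 1 [← hPs]; rw [vecMul_transpose]
      have hx2 := congrArg (fun v => x ⬝ᵥ v) hx1
      simp only [dotProduct_add, dotProduct_sub, dotProduct_smul, hxZ, hxP, dotProduct_zero,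
        smul_eq_mul, zero_add, mul_zero, sub_zero] at hx2
      have hQx := (posSemidef_real_iff.1 hQ).2 x
      have hSx := (posSemidef_real_iff.1 hS).2 (P *ᵥ x)
      have hp1 : 0 < 1 - θ := by linarith
      have hp2 : 0 < θ * (1 - θ) := mul_pos h0 hp1
      have hq1 := mul_nonneg hp1.le hQx
      have hq2 := mul_nonneg hp2.le hSx
      have hQ0 : Q *ᵥ x = 0 := (posSemidef_mulVec_eq_zero_iff hQ x).1
        ((mul_eq_zero.1 (by linarith : (1 - θ) * (x ⬝ᵥ Q *ᵥ x) = 0)).resolve_left hp1.ne')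
      have hS0 : S *ᵥ (P *ᵥ x) = 0 := (posSemidef_mulVec_eq_zero_iff hS _).1
        ((mul_eq_zero.1 (by linarith : θ * (1 - θ) * ((P *ᵥ x) ⬝ᵥ S *ᵥ (P *ᵥ x)) = 0)).resolve_left
          hp2.ne')
      refine ⟨hS0, by simpa [hQ0, hS0] using hx1, ?_⟩
      have hx3 := congrArg (fun M => M *ᵥ x) hPric
      simp only [ric, add_mulVec, sub_mulVec, ← mulVec_mulVec, hQ0, hS0, mulVec_zero, add_zero,
        sub_zero, zero_mulVec] at hx3
      exact (neg_eq_of_add_eq_zero_right hx3).symm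
    have hall : ∀ k : ℕ, ∀ x, Z *ᵥ x = 0 → S *ᵥ (a ^ k *ᵥ (P *ᵥ x)) = 0 := by
      intro k
      induction k with
      | zero => intro x hx; simpa using (hstep x hx).1
      | succ k ih =>
        intro x hx
        obtain ⟨-, h3, h4⟩ := hstep x hx
        have h5 := ih _ h3
        rw [h4, mulVec_neg, mulVec_neg, neg_eq_zero] at h5
        rw [pow_succ, ← mulVec_mulVec, h5]
    exact fun x hx => hobs _ fun k => hall k x hx
  have hmem : ∀ θ : ℝ, (R - θ • P).PosSemidef ↔ ∀ x, θ * (x ⬝ᵥ P *ᵥ x) ≤ x ⬝ᵥ R *ᵥ x := by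
    intro θ
    rw [posSemidef_real_iff]
    simp [hPs, hRs, sub_mulVec, smul_mulVec]
  -- Take the largest `m ≤ 1` with `R ≥ mP`. If `m < 1`, the kernel inclusion gives `R - mP ≥ δP`
  -- for some `δ > 0`, and `m` could be increased.
  have hcomp : IsCompact (Set.Icc (0 : ℝ) 1 ∩ {θ | (R - θ • P).PosSemidef}) := by
    refine isCompact_Icc.inter_right ?_
    simp only [hmem, Set.ofPred_forall]
    exact isClosed_iInter fun x => isClosed_le (by fun_prop) continuous_const
  obtain ⟨m, ⟨hm01, hmR⟩, hmax⟩ := hcomp.exists_isGreatest ⟨θ, ⟨hθ.le, hθ1⟩, hθR⟩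
  have hm0 : 0 < m := hθ.trans_le (hmax ⟨⟨hθ.le, hθ1⟩, hθR⟩)
  have hm1 : m = 1 := by
    by_contra hne
    have hlt : m < 1 := lt_of_le_of_ne hm01.2 hne
    obtain ⟨δ, hδ, hδP⟩ := exists_posSemidef_sub_smul hmR hP (hker m hm0 hlt hmR)
    have hpos : 0 < min δ (1 - m) := lt_min hδ (by linarith)
    have hin : (R - (m + min δ (1 - m)) • P).PosSemidef := by
      have := hδP.add (hP.smul (sub_nonneg.2 (min_le_left δ (1 - m))))
      convert this using 1
      simp only [add_smul, sub_smul]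
      abel
    have := hmax ⟨⟨by linarith, by linarith [min_le_right δ (1 - m)]⟩, hin⟩
    linarith
  rw [hm1, Set.mem_ofPred_eq, one_smul] at hmR
  open scoped MatrixOrder in
  exact le_antisymm (Matrix.le_iff.2 hRP) (Matrix.le_iff.2 hmR)

end RiccatiLimit
-- Supersolutions from a Lyapunov equation, and the common limit.
section RiccatiLimit

open Matrix

variable {ι : Type*} [Fintype ι] [DecidableEq ι] {a Q S : Matrix ι ι ℝ}

/-- Some shift of `a` has positive definite symmetric part. -/
theorem exists_posDef_shift (a : Matrix ι ι ℝ) :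
    ∃ β : ℝ, 1 ≤ β ∧ ((a + β • 1) + (a + β • 1)ᵀ).PosDef := by
  have h0 : (a * aᵀ).PosSemidef := by
    simpa using posSemidef_self_mul_conjTranspose a
  obtain ⟨δ, hδ, h⟩ := exists_posSemidef_sub_smul (Matrix.PosSemidef.one (n := ι) (R := ℝ)) h0
    fun x hx => by rw [one_mulVec] at hx; rw [hx, mulVec_zero]
  refine ⟨δ⁻¹ + 1, by linarith [inv_pos.2 hδ], ?_⟩
  have h1 := h.smul (inv_pos.2 hδ).le
  have h2 : ((a + 1) * (a + 1)ᵀ).PosSemidef := by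
    rw [← conjTranspose_eq_transpose_of_trivial]
    exact posSemidef_self_mul_conjTranspose (a + 1)
  -- With `β = δ⁻¹ + 1`, the shifted symmetric part is `1 + δ⁻¹ + (δ⁻¹ - aaᵀ) + (a + 1)(a + 1)ᵀ`.
  have h3 := (((Matrix.PosDef.one (n := ι) (R := ℝ)).add_posSemidef
    ((Matrix.PosSemidef.one (n := ι) (R := ℝ)).smul (inv_pos.2 hδ).le))).add_posSemidef (h1.add h2)
  convert h3 using 1
  rw [smul_sub, smul_smul, inv_mul_cancel₀ hδ.ne', transpose_add, transpose_add, transpose_smul,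
    transpose_one, add_smul]
  simp only [Matrix.add_mul, Matrix.mul_add, Matrix.one_mul, Matrix.mul_one, one_smul]
  abel

/-- The Lyapunov equation is solvable if `B` has positive definite symmetric part. -/
theorem exists_lyapunov {B : Matrix ι ι ℝ} (hB : (B + Bᵀ).PosDef) (hS : Sᵀ = S) :
    ∃ Y : Matrix ι ι ℝ, Yᵀ = Y ∧ Bᵀ * Y + Y * B = S := by
  let f : Matrix ι ι ℝ →ₗ[ℝ] Matrix ι ι ℝ := LinearMap.mulLeft ℝ Bᵀ + LinearMap.mulRight ℝ B
  have hf : ∀ Y, f Y = Bᵀ * Y + Y * B := fun _ => rfl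
  have hinj : Function.Injective f := by
    refine (injective_iff_map_eq_zero f).2 fun Y hY => ?_
    rw [hf] at hY
    have h1 := posSemidef_transpose_mul_mul hB.posSemidef Y
    have h2 : (Y * (B + Bᵀ) * Yᵀ).PosSemidef := by
      simpa using posSemidef_transpose_mul_mul hB.posSemidef Yᵀ
    have e1 : trace (Yᵀ * B * Y) = trace (Yᵀ * (Bᵀ * Y)) := by
      rw [← trace_transpose]
      simp [Matrix.mul_assoc]
    have e2 : trace (Y * B * Yᵀ) = trace (Yᵀ * (Y * B)) := by
      rw [trace_mul_comm]
    have e3 : trace (Y * Bᵀ * Yᵀ) = trace (Yᵀ * (Y * B)) := by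
      rw [← e2, ← trace_transpose]
      simp [Matrix.mul_assoc]
    -- Pairing the homogeneous equation with `Y` under the trace gives two nonnegative terms with
    -- sum zero, so both vanish.
    have e4 : trace (Yᵀ * (B + Bᵀ) * Y) + trace (Y * (B + Bᵀ) * Yᵀ) = 0 := by
      have := congrArg (fun M => trace (Yᵀ * M)) hY
      simp only [Matrix.mul_add, trace_add, Matrix.mul_zero, trace_zero] at this
      simp only [Matrix.mul_add, Matrix.add_mul, trace_add, e1, e2, e3]
      rw [Matrix.mul_assoc]
      linarith
    have e5 : trace (Yᵀ * (B + Bᵀ) * Y) = 0 :=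
      le_antisymm (by linarith [h2.trace_nonneg]) h1.trace_nonneg
    rw [h1.trace_eq_zero_iff] at e5
    refine ext_of_mulVec_single fun i => ?_
    rw [zero_mulVec]
    refine PosDef.mulVec_eq_zero hB ((posSemidef_mulVec_eq_zero_iff hB.posSemidef _).1 ?_)
    have := congrArg (fun M => Pi.single i 1 ⬝ᵥ M *ᵥ Pi.single i 1) e5
    rwa [Matrix.mul_assoc, ← mulVec_mulVec, dotProduct_mulVec, vecMul_transpose, ← mulVec_mulVec,
      zero_mulVec, dotProduct_zero] at this
  obtain ⟨Y, hY⟩ := (LinearMap.injective_iff_surjective.1 hinj) S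
  refine ⟨Y, hinj ?_, hY⟩
  rw [hY, ← hS, ← hY, hf, hf]
  simp [add_comm]

/-- The solution of the Lyapunov equation is positive definite in the observable case. -/
theorem posDef_of_lyapunov (hobs : ∀ x, (∀ k : ℕ, S *ᵥ (a ^ k *ᵥ x) = 0) → x = 0)
    (hS : S.PosSemidef) {β : ℝ} (hB : ((a + β • 1) + (a + β • 1)ᵀ).PosDef) {Y : Matrix ι ι ℝ}
    (hYs : Yᵀ = Y) (hY : (a + β • 1)ᵀ * Y + Y * (a + β • 1) = S) : Y.PosDef := by
  have hYh : Y.IsHermitian := by simpa [IsHermitian] using hYs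
  have hker : ∀ x, Y *ᵥ x = 0 → S *ᵥ x = 0 ∧ Y *ᵥ (a *ᵥ x) = 0 := by
    intro x hx
    have h1 : Y *ᵥ ((a + β • 1) *ᵥ x) = S *ᵥ x := by
      rw [← hY, add_mulVec _ (Y * _), ← mulVec_mulVec, ← mulVec_mulVec, hx, mulVec_zero, zero_add]
    have h2 : S *ᵥ x = 0 := by
      rw [← posSemidef_mulVec_eq_zero_iff hS, ← h1, dotProduct_mulVec, ← hYs, vecMul_transpose, hx,
        zero_dotProduct]
    refine ⟨h2, ?_⟩
    rw [h2, add_mulVec, mulVec_add, smul_mulVec, one_mulVec, mulVec_smul, hx, smul_zero,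
      add_zero] at h1
    exact h1
  have hker0 : ∀ x, Y *ᵥ x = 0 → x = 0 := by
    have : ∀ k : ℕ, ∀ x, Y *ᵥ x = 0 → S *ᵥ (a ^ k *ᵥ x) = 0 := by
      intro k
      induction k with
      | zero => intro x hx; simpa using (hker x hx).1
      | succ k ih =>
        intro x hx
        rw [pow_succ, ← mulVec_mulVec, ih _ (hker x hx).2]
    exact fun x hx => hobs x fun k => this k x hx
  refine hYh.posDef_iff_eigenvalues_pos.2 fun i => ?_
  set μ := hYh.eigenvalues i
  set x : ι → ℝ := ⇑(hYh.eigenvectorBasis i) with hx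
  have hxμ : Y *ᵥ x = μ • x := hYh.mulVec_eigenvectorBasis i
  have hx0 : x ≠ 0 := by
    intro h
    refine hYh.eigenvectorBasis.orthonormal.ne_zero i ?_
    ext j
    exact congrFun h j
  -- The Lyapunov equation tested on an eigenvector of `Y` gives `μ ≥ 0`; `μ = 0` is excluded by the
  -- trivial kernel.
  have h1 : x ⬝ᵥ S *ᵥ x = μ * (x ⬝ᵥ ((a + β • 1) + (a + β • 1)ᵀ) *ᵥ x) := by
    have h0 : x ᵥ* Y = μ • x := by rw [← hxμ, ← vecMul_transpose, hYs]
    rw [← hY, add_mulVec, ← mulVec_mulVec, hxμ, dotProduct_add, ← mulVec_mulVec,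
      dotProduct_mulVec x Y, h0, add_mulVec (a + _), dotProduct_add,
      mulVec_smul, dotProduct_smul, smul_dotProduct, smul_eq_mul, smul_eq_mul]
    ring
  have h2 := (posDef_real_iff.1 hB).2 x hx0
  have h3 := (posSemidef_real_iff.1 hS).2 x
  rw [h1] at h3
  refine lt_of_le_of_ne (nonneg_of_mul_nonneg_left h3 h2) fun h => hx0 (hker0 x ?_)
  rw [hxμ, ← h, zero_smul]

/-- In the observable case there are arbitrarily large supersolutions of the algebraic Riccati
equation. -/
theorem exists_supersolution (hobs : ∀ x, (∀ k : ℕ, S *ᵥ (a ^ k *ᵥ x) = 0) → x = 0)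
    (hQ : Q.PosSemidef) (hS : S.PosSemidef) {R₀ : Matrix ι ι ℝ} (hR₀ : R₀.PosSemidef) :
    ∃ P : Matrix ι ι ℝ, P.PosSemidef ∧ (-ric a Q S P).PosSemidef ∧ (P - R₀).PosSemidef := by
  obtain ⟨β, hβ, hB⟩ := exists_posDef_shift a
  obtain ⟨Y, hYs, hY⟩ := exists_lyapunov hB (PosSemidef.transpose_eq hS)
  have hYp := posDef_of_lyapunov hobs hS hB hYs hY
  have hYQY : (Y * Q * Y).PosSemidef := by
    have := posSemidef_transpose_mul_mul hQ Y
    rwa [hYs] at this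
  obtain ⟨δ, hδ, hδY⟩ := exists_posSemidef_sub_smul hYp.posSemidef hYQY fun x hx => by
    rw [PosDef.mulVec_eq_zero hYp hx, mulVec_zero]
  obtain ⟨δ', hδ', hδR⟩ := exists_posSemidef_sub_smul hYp.inv.posSemidef hR₀ fun x hx => by
    rw [PosDef.mulVec_eq_zero hYp.inv hx, mulVec_zero]
  -- The supersolution is `P = (εY)⁻¹`: `ε ≤ 1` and `ε ≤ δ` serve the Riccati inequality, `ε ≤ δ'`
  -- serves `P ≥ R₀`.
  set ε := min 1 (min δ δ') with hε
  have hε0 : 0 < ε := lt_min one_pos (lt_min hδ hδ')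
  have hε1 : ε ≤ 1 := min_le_left _ _
  have hεδ : ε ≤ δ := (min_le_right _ _).trans (min_le_left _ _)
  have hεδ' : ε ≤ δ' := (min_le_right _ _).trans (min_le_right _ _)
  have hP : (ε⁻¹ • Y⁻¹).PosSemidef := hYp.inv.posSemidef.smul (inv_pos.2 hε0).le
  have hPs := PosSemidef.transpose_eq hP
  have hYi : Y⁻¹ * Y = 1 := nonsing_inv_mul _ ((isUnit_iff_isUnit_det _).1 hYp.isUnit)
  have hYi' : Y * Y⁻¹ = 1 := mul_nonsing_inv _ ((isUnit_iff_isUnit_det _).1 hYp.isUnit)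
  have hPZ : (ε⁻¹ • Y⁻¹) * (ε • Y) = 1 := by
    rw [Matrix.smul_mul, Matrix.mul_smul, smul_smul, inv_mul_cancel₀ hε0.ne', hYi, one_smul]
  have hZP : (ε • Y) * (ε⁻¹ • Y⁻¹) = 1 := by
    rw [Matrix.smul_mul, Matrix.mul_smul, smul_smul, mul_inv_cancel₀ hε0.ne', hYi', one_smul]
  refine ⟨ε⁻¹ • Y⁻¹, hP, ?_, ?_⟩
  · set P := ε⁻¹ • Y⁻¹
    set Z := ε • Y with hZ
    -- This is the required inequality conjugated by `Z = P⁻¹`. The left side equals `(1 - ε)S +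
    -- ε[(2β - 1)Y + (Y - δYQY) + (δ - ε)YQY]`.
    have hM : (S - (Z * a + aᵀ * Z + Z * Q * Z)).PosSemidef := by
      have hL : Y * a + aᵀ * Y = S - (2 * β) • Y := by
        rw [← hY, transpose_add, transpose_smul, transpose_one, two_mul, add_smul]
        simp only [Matrix.add_mul, Matrix.mul_add, Matrix.smul_mul, Matrix.mul_smul,
          Matrix.one_mul, Matrix.mul_one]
        abel
      have h1 := hS.smul (sub_nonneg.2 hε1)
      have h2 := hYp.posSemidef.smul (show 0 ≤ 2 * β - 1 by linarith)
      have h3 := hYQY.smul (sub_nonneg.2 hεδ)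
      have h4 := h1.add (((h2.add hδY).add h3).smul hε0.le)
      convert h4 using 1
      have h5 : Z * a + aᵀ * Z = ε • (Y * a + aᵀ * Y) := by
        rw [hZ, smul_add, Matrix.smul_mul, Matrix.mul_smul]
      rw [h5, hL, hZ]
      simp only [Matrix.smul_mul, Matrix.mul_smul, smul_add, smul_sub, smul_smul, sub_smul,
        one_smul]
      abel
    have h6 := posSemidef_transpose_mul_mul hM P
    convert h6 using 1
    rw [hPs, ric]
    have h7 : P * (S - (Z * a + aᵀ * Z + Z * Q * Z)) * P =
        P * S * P - ((P * Z) * a * P + P * aᵀ * (Z * P) + (P * Z) * Q * (Z * P)) := by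
      noncomm_ring
    rw [h7, hPZ, hZP]
    noncomm_ring
  · have h1 := (hδR.add (hR₀.smul (sub_nonneg.2 hεδ'))).smul (inv_pos.2 hε0).le
    convert h1 using 1
    rw [sub_smul, smul_add, smul_sub, smul_sub, smul_smul ε⁻¹ ε, inv_mul_cancel₀ hε0.ne', one_smul]
    abel

theorem IsRiccatiFlow.exists_tendsto_of_supersolution (hS : S.PosSemidef)
    {R X : ℝ → Matrix ι ι ℝ} (h : IsRiccatiFlow a Q S R X)
    (hric : (-ric a Q S (R 0)).PosSemidef) : ∃ P, Tendsto R atTop (𝓝 P) := by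
  obtain ⟨L, hL⟩ := exists_tendsto_of_monotone (R := fun t => -R t) (P := 0)
    (fun t ht => by rw [transpose_neg, h.transpose_eq t ht])
    (fun s t hs hst => by
      have := h.antitone hS hric hs hst
      rwa [← neg_sub_neg] at this)
    (fun t ht => by simpa using h.posSemidef t ht)
  exact ⟨-L, by simpa using hL.neg⟩

/-- Squeeze: `R` lies between the increasing flow from `θP` and the flow `R₁`. Positive definiteness
of `R 0` is what provides `θ > 0`, even if `P` is singular. -/
theorem tendsto_of_tendsto_supersolution
    (hobs : ∀ x, (∀ k : ℕ, S *ᵥ (a ^ k *ᵥ x) = 0) → x = 0) (hQ : Q.PosSemidef) (hS : S.PosSemidef)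
    {R₁ X₁ R X : ℝ → Matrix ι ι ℝ} (h₁ : IsRiccatiFlow a Q S R₁ X₁) {P : Matrix ι ι ℝ}
    (hP : Tendsto R₁ atTop (𝓝 P)) (h : IsRiccatiFlow a Q S R X) (h0 : (R 0).PosDef)
    (hle : (R₁ 0 - R 0).PosSemidef) : Tendsto R atTop (𝓝 P) := by
  have hPp := posSemidef_of_tendsto hP h₁.posSemidef
  have hPric := h₁.ric_eq_zero_of_tendsto hP
  obtain ⟨δ, hδ, hδP⟩ := exists_posSemidef_sub_smul h0.posSemidef hPp fun x hx => by
    rw [PosDef.mulVec_eq_zero h0 hx, mulVec_zero]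
  set θ := min δ 1
  have hθ : 0 < θ := lt_min hδ one_pos
  have hθ1 : θ ≤ 1 := min_le_right _ _
  have hθR : (R 0 - θ • P).PosSemidef := by
    convert hδP.add (hPp.smul (sub_nonneg.2 (min_le_left δ 1))) using 1
    rw [sub_smul]
    abel
  have hθp := hPp.smul hθ.le
  obtain ⟨L, Y, hL0, hL⟩ := exists_isRiccatiFlow (a := a) hQ hS hθp
  have hsub : (ric a Q S (L 0)).PosSemidef := by
    rw [hL0, ric_smul, hPric, smul_zero, zero_add]
    refine (hQ.smul (sub_nonneg.2 hθ1)).add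
      (PosSemidef.smul ?_ (mul_nonneg hθ.le (sub_nonneg.2 hθ1)))
    have := posSemidef_transpose_mul_mul hS P
    rwa [PosSemidef.transpose_eq hPp] at this
  have hLP : ∀ t, 0 ≤ t → (P - L t).PosSemidef :=
    hL.le_of_supersolution hS (PosSemidef.transpose_eq hPp)
      (by simpa [hPric] using Matrix.PosSemidef.zero) (by
        rw [hL0]
        convert hPp.smul (sub_nonneg.2 hθ1) using 1
        rw [sub_smul, one_smul])
  obtain ⟨M, hM⟩ := exists_tendsto_of_monotone hL.transpose_eq
    (fun s t hs hst => hL.monotone hS hsub hs hst) hLP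
  have hMP : M = P := eq_of_ric_eq_zero hobs hQ hS hPp hPric (hL.ric_eq_zero_of_tendsto hM)
    (posSemidef_of_tendsto (tendsto_const_nhds.sub hM) hLP) hθ hθ1
    (posSemidef_of_tendsto (hM.sub tendsto_const_nhds) fun t ht => by
      have := hL.monotone hS hsub le_rfl ht
      rwa [hL0] at this)
  rw [hMP] at hM
  exact tendsto_of_sandwich (PosSemidef.transpose_eq hPp) h.transpose_eq
    (hL.mono hS h (by rwa [hL0])) (h.mono hS h₁ hle) hM hP

/-- In the observable case all solutions of the Riccati equation with positive definite initial
value converge to the same limit. -/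
theorem exists_riccati_limit (hobs : ∀ x, (∀ k : ℕ, S *ᵥ (a ^ k *ᵥ x) = 0) → x = 0)
    (hQ : Q.PosSemidef) (hS : S.PosSemidef) :
    ∃ P, ∀ R X : ℝ → Matrix ι ι ℝ, IsRiccatiFlow a Q S R X → (R 0).PosDef →
      Tendsto R atTop (𝓝 P) := by
  have key : ∀ R₀ : Matrix ι ι ℝ, R₀.PosSemidef → ∃ R X P, IsRiccatiFlow a Q S R X ∧
      (R 0 - R₀).PosSemidef ∧ Tendsto R atTop (𝓝 P) := by
    intro R₀ hR₀
    obtain ⟨P, hP, hric, hle⟩ := exists_supersolution hobs hQ hS hR₀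
    obtain ⟨R, X, hR0, hR⟩ := exists_isRiccatiFlow (a := a) hQ hS hP
    obtain ⟨L, hL⟩ := hR.exists_tendsto_of_supersolution hS (by rwa [hR0])
    exact ⟨R, X, L, hR, by rwa [hR0], hL⟩
  obtain ⟨R₁, X₁, P, h₁, h₁0, hP⟩ := key 1 Matrix.PosSemidef.one
  have h₁d : (R₁ 0).PosDef := by
    simpa using (Matrix.PosDef.one (n := ι) (R := ℝ)).posSemidef_add h₁0
  refine ⟨P, fun R X h h0 => ?_⟩
  -- A start above both `R₁ 0` and `R 0` forces both flows to `P₂`; since `R₁` tends to `P`, `P₂ =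
  -- P`.
  obtain ⟨R₂, X₂, P₂, h₂, h₂0, hP₂⟩ := key (R₁ 0 + R 0) (h₁d.posSemidef.add h0.posSemidef)
  have e := tendsto_of_tendsto_supersolution hobs hQ hS h₂ hP₂ h₁ h₁d
    (by simpa [sub_add_eq_sub_sub] using h₂0.add h0.posSemidef)
  rw [tendsto_nhds_unique hP e]
  refine tendsto_of_tendsto_supersolution hobs hQ hS h₂ hP₂ h h0 ?_
  convert h₂0.add h₁d.posSemidef using 1
  abel

end RiccatiLimit
-- The stable set: invariance and uniqueness of the column space.
section StableSet

open Matrix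

variable {n r : ℕ}

theorem eq_padZero_of_forall_eq_zero (hrn : r ≤ n) {W : Matrix (Fin n) (Fin r) ℂ}
    (h : ∀ i j, r ≤ i.val → W i j = 0) :
    W = padZero n (W.submatrix (Fin.castLE hrn) id) := by
  ext i j
  by_cases hi : i.val < r
  · simp [padZero, hi]
  · simp [padZero, hi, h i j (not_lt.1 hi)]

theorem padZero_mul (K N : Matrix (Fin r) (Fin r) ℂ) : padZero n (K * N) = padZero n K * N := by
  ext i j
  by_cases hi : i.val < r <;> simp [padZero, hi, mul_apply]

/-- A matrix with vanishing lower block factors through `padZero n K` for invertible `K`. -/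
theorem exists_eq_padZero_mul (hrn : r ≤ n) {K : Matrix (Fin r) (Fin r) ℂ} (hK : IsUnit K.det)
    {W : Matrix (Fin n) (Fin r) ℂ} (h : ∀ i j, r ≤ i.val → W i j = 0) :
    ∃ N : Matrix (Fin r) (Fin r) ℂ, W = padZero n K * N := by
  refine ⟨K⁻¹ * W.submatrix (Fin.castLE hrn) id, ?_⟩
  rw [← padZero_mul, mul_nonsing_inv_cancel_left _ _ hK]
  exact eq_padZero_of_forall_eq_zero hrn h

theorem mul_padZero_eq_zero {T : Matrix (Fin n) (Fin n) ℂ} (K : Matrix (Fin r) (Fin r) ℂ)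
    (hT : ∀ i j : Fin n, r ≤ i.val → j.val < r → T i j = 0) (i : Fin n) (j : Fin r)
    (hi : r ≤ i.val) : (T * padZero n K) i j = 0 := by
  rw [mul_apply]
  refine Finset.sum_eq_zero fun k _ => ?_
  by_cases hk : k.val < r
  · rw [hT i k hi hk, zero_mul]
  · simp [padZero, hk]

theorem IsOrderedJordanMatrix.eq_zero_of_lt {Λ : Matrix (Fin n) (Fin n) ℂ}
    (h : IsOrderedJordanMatrix Λ) {i j : Fin n} (hij : j < i) : Λ i j = 0 := by
  by_contra h0
  have h1 := (h.1 i j hij.ne' h0).1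
  have h2 : j.val < i.val := hij
  omega

theorem IsOrderedJordanBasis.mul_eq {A : Matrix (Fin n) (Fin n) ℝ} {Ψ : Matrix (Fin n) (Fin n) ℂ}
    (h : IsOrderedJordanBasis A Ψ) :
    A.map Complex.ofReal * Ψ = Ψ * (Ψ⁻¹ * A.map Complex.ofReal * Ψ) := by
  rw [Matrix.mul_assoc Ψ⁻¹, mul_nonsing_inv_cancel_left _ _ h.1]

theorem antitone_eq_of_map_eq {f g : Fin n → ℝ} (hf : Antitone f) (hg : Antitone g)
    (h : Finset.univ.val.map f = Finset.univ.val.map g) : f = g := by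
  rw [Fin.univ_val_map, Fin.univ_val_map, Multiset.coe_eq_coe] at h
  exact List.ofFn_injective (h.eq_of_sortedGE hf.sortedGE_ofFn hg.sortedGE_ofFn)

/-- The real parts of the diagonal of an ordered Jordan form are those of the ordered spectrum. -/
theorem IsOrderedSpectrum.re_diag {A : Matrix (Fin n) (Fin n) ℝ} {lam : Fin n → ℂ}
    (hlam : IsOrderedSpectrum A lam) {Ψ : Matrix (Fin n) (Fin n) ℂ}
    (hΨ : IsOrderedJordanBasis A Ψ) (i : Fin n) :
    ((Ψ⁻¹ * A.map Complex.ofReal * Ψ) i i).re = (lam i).re := by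
  set Λ := Ψ⁻¹ * A.map Complex.ofReal * Ψ with hΛ
  have h1 : Λ.charpoly = (A.map Complex.ofReal).charpoly := by
    rw [hΛ, charpoly_mul_comm, ← Matrix.mul_assoc, mul_nonsing_inv _ hΨ.1, Matrix.one_mul]
  have h2 : Λ.charpoly.roots = Finset.univ.val.map fun i => Λ i i := by
    rw [charpoly_of_isUpperTriangular Λ fun i j hij => hΨ.2.eq_zero_of_lt hij,
      ← Polynomial.roots_multiset_prod_X_sub_C (Finset.univ.val.map fun i => Λ i i)]
    rw [Multiset.map_map]
    rfl
  rw [h1, hlam.1] at h2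
  -- Eigenvalues with equal real parts may appear in different orders, so only the sorted real parts
  -- can be matched.
  have h3 := congrArg (Multiset.map Complex.re) h2
  simp only [Multiset.map_map, Function.comp_def] at h3
  exact (congrFun (antitone_eq_of_map_eq hlam.2 hΨ.2.2 h3) i).symm

/-- Two Jordan matrices intertwined by `T`: the block of `T` that joins separated parts of the
diagonals vanishes. -/
theorem intertwiner_eq_zero {Λ₁ Λ₂ T : Matrix (Fin n) (Fin n) ℂ} (h₁ : IsOrderedJordanMatrix Λ₁)
    (h₂ : IsOrderedJordanMatrix Λ₂) (hT : Λ₂ * T = T * Λ₁)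
    (hsep : ∀ i j : Fin n, r ≤ i.val → j.val < r → Λ₂ i i ≠ Λ₁ j j) :
    ∀ i j : Fin n, r ≤ i.val → j.val < r → T i j = 0 := by
  -- Entry `(i, j)` of `Λ₂T = TΛ₁` involves, besides `T i j`, only the entries of `T` just below and
  -- just to the left; both have smaller `n - i + j` and stay in the block.
  have key : ∀ m : ℕ, ∀ i j : Fin n, n - i.val + j.val = m → r ≤ i.val → j.val < r →
      T i j = 0 := by
    intro m
    induction m using Nat.strong_induction_on with
    | _ m ih =>
      intro i j hm hi hj
      have h := congrFun (congrFun hT i) j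
      rw [mul_apply, mul_apply, Finset.sum_eq_single i ?_ (by simp),
        Finset.sum_eq_single j ?_ (by simp), mul_comm, ← sub_eq_zero, ← mul_sub] at h
      · exact (mul_eq_zero.1 h).resolve_right (sub_ne_zero.2 (hsep i j hi hj))
      · intro k _ hk
        by_cases h0 : Λ₁ k j = 0
        · rw [h0, mul_zero]
        · have := (h₁.1 k j hk h0).1
          rw [ih _ (by omega) i k rfl hi (by omega), zero_mul]
      · intro k _ hk
        by_cases h0 : Λ₂ i k = 0
        · rw [h0, zero_mul]
        · have := (h₂.1 i k hk.symm h0).1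
          have := k.isLt
          rw [ih _ (by omega) k j rfl (by omega) hj, mul_zero]
  exact fun i j => key _ i j rfl

/-- If the columns of the real matrix `V` are complex combinations of the orthonormal columns of
`U`, then `U Uᵀ` fixes `V`. -/
theorem eq_mul_transpose_mul_of_map {m : ℕ} {U : Matrix (Fin n) (Fin r) ℝ} (hU : Uᵀ * U = 1)
    {V : Matrix (Fin n) (Fin m) ℝ} {N : Matrix (Fin r) (Fin m) ℂ}
    (h : V.map Complex.ofReal = U.map Complex.ofReal * N) : V = U * (Uᵀ * V) := by
  have hmul : ∀ {k l p : ℕ} (X : Matrix (Fin k) (Fin l) ℝ) (Y : Matrix (Fin l) (Fin p) ℝ),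
      (X * Y).map Complex.ofReal = X.map Complex.ofReal * Y.map Complex.ofReal :=
    fun X Y => Matrix.map_mul (f := Complex.ofRealHom)
  have h1 : Uᵀ.map Complex.ofReal * U.map Complex.ofReal = 1 := by
    rw [← hmul, hU]
    exact Matrix.map_one _ Complex.ofReal_zero Complex.ofReal_one
  have h2 : V.map Complex.ofReal = (U * (Uᵀ * V)).map Complex.ofReal := by
    rw [hmul, hmul, h, ← Matrix.mul_assoc (Uᵀ.map _), h1, Matrix.one_mul]
  exact Matrix.map_injective Complex.ofReal_injective h2

/-- The columns of an element of the stable set span an invariant subspace. -/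
theorem mul_eq_of_mem_ojaStableSet (hrn : r ≤ n) {A : Matrix (Fin n) (Fin n) ℝ}
    {U : Matrix (Fin n) (Fin r) ℝ} (hU : U ∈ ojaStableSet r A) : A * U = U * (Uᵀ * A * U) := by
  obtain ⟨hU1, Ψ, K, hΨ, hK, hUK⟩ := hU
  obtain ⟨N, hN⟩ := exists_eq_padZero_mul hrn hK
    (mul_padZero_eq_zero (T := Ψ⁻¹ * A.map Complex.ofReal * Ψ) K fun i j hi hj =>
      hΨ.2.eq_zero_of_lt (show j.val < i.val by omega))
  rw [Matrix.mul_assoc Uᵀ]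
  refine eq_mul_transpose_mul_of_map (N := N) hU1 ?_
  have h1 : (A * U).map Complex.ofReal = A.map Complex.ofReal * U.map Complex.ofReal :=
    Matrix.map_mul (f := Complex.ofRealHom)
  rw [h1, hUK, ← Matrix.mul_assoc, hΨ.mul_eq, Matrix.mul_assoc Ψ, hN, Matrix.mul_assoc]

/-- All elements of the stable set have the same column space. -/
theorem eq_mul_of_mem_ojaStableSet (hrn : r ≤ n) {A : Matrix (Fin n) (Fin n) ℝ}
    {lam : Fin n → ℂ} (hlam : IsOrderedSpectrum A lam)
    (hgap : ∀ i j : Fin n, r ≤ i.val → j.val < r → (lam i).re < (lam j).re)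
    {U₁ U₂ : Matrix (Fin n) (Fin r) ℝ} (hU₁ : U₁ ∈ ojaStableSet r A)
    (hU₂ : U₂ ∈ ojaStableSet r A) : U₁ = U₂ * (U₂ᵀ * U₁) := by
  obtain ⟨-, Ψ₁, K₁, hΨ₁, hK₁, hUK₁⟩ := hU₁
  obtain ⟨hU₂1, Ψ₂, K₂, hΨ₂, hK₂, hUK₂⟩ := hU₂
  -- The transition matrix between the two bases intertwines the two Jordan forms.
  have hT : (Ψ₂⁻¹ * A.map Complex.ofReal * Ψ₂) * (Ψ₂⁻¹ * Ψ₁) =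
      (Ψ₂⁻¹ * Ψ₁) * (Ψ₁⁻¹ * A.map Complex.ofReal * Ψ₁) := by
    rw [Matrix.mul_assoc _ Ψ₂, mul_nonsing_inv_cancel_left _ _ hΨ₂.1, Matrix.mul_assoc Ψ₂⁻¹ Ψ₁,
      ← hΨ₁.mul_eq, Matrix.mul_assoc]
  have hsep : ∀ i j : Fin n, r ≤ i.val → j.val < r →
      (Ψ₂⁻¹ * A.map Complex.ofReal * Ψ₂) i i ≠ (Ψ₁⁻¹ * A.map Complex.ofReal * Ψ₁) j j := by
    intro i j hi hj h
    have h1 := congrArg Complex.re h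
    rw [hlam.re_diag hΨ₂, hlam.re_diag hΨ₁] at h1
    exact (hgap i j hi hj).ne h1
  obtain ⟨N, hN⟩ := exists_eq_padZero_mul hrn hK₂
    (mul_padZero_eq_zero K₁ (intertwiner_eq_zero hΨ₁.2 hΨ₂.2 hT hsep))
  refine eq_mul_transpose_mul_of_map (N := N) hU₂1 ?_
  rw [hUK₁, hUK₂, Matrix.mul_assoc, ← hN, Matrix.mul_assoc,
    mul_nonsing_inv_cancel_left _ _ hΨ₂.1]

theorem IsObservable.eq_zero {p : ℕ} {C : Matrix (Fin p) (Fin n) ℝ} {A : Matrix (Fin n) (Fin n) ℝ}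
    (h : IsObservable C A) {x : Fin n → ℝ} (hx : ∀ k : ℕ, C *ᵥ (A ^ k *ᵥ x) = 0) : x = 0 := by
  rw [IsObservable, rank] at h
  set M : Matrix (Fin n × Fin p) (Fin n) ℝ := Matrix.of fun ki j => (C * A ^ ki.1.val) ki.2 j
  have h1 := LinearMap.finrank_range_add_finrank_ker M.mulVecLin
  rw [h, Module.finrank_fin_fun, Nat.add_eq_left, Submodule.finrank_eq_zero] at h1
  refine (Submodule.eq_bot_iff _).1 h1 x ?_
  rw [LinearMap.mem_ker, mulVecLin_apply]
  ext ki
  have := congrFun (hx ki.1.val) ki.2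
  rw [mulVec_mulVec] at this
  exact this

end StableSet
-- The filter at rest on the stable set, and equivariance.
section FilterSolution

open Matrix

variable {n r p : ℕ}

theorem HasDerivOnHalfLine.const_mul {k l m : ℕ} {M M' : ℝ → Matrix (Fin k) (Fin l) ℝ}
    (h : HasDerivOnHalfLine M M') (B : Matrix (Fin m) (Fin k) ℝ) :
    HasDerivOnHalfLine (fun t => B * M t) fun t => B * M' t := fun t ht i j => by
  simp only [mul_apply]
  exact HasDerivWithinAt.fun_sum fun q _ => (h t ht q j).const_mul _

theorem HasDerivOnHalfLine.mul_const {k l m : ℕ} {M M' : ℝ → Matrix (Fin k) (Fin l) ℝ}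
    (h : HasDerivOnHalfLine M M') (B : Matrix (Fin l) (Fin m) ℝ) :
    HasDerivOnHalfLine (fun t => M t * B) fun t => M' t * B := fun t ht i j => by
  simp only [mul_apply]
  exact HasDerivWithinAt.fun_sum fun q _ => (h t ht i q).mul_const _

/-- Uniqueness of solutions of a matrix equation with `C¹` right-hand side. -/
theorem HasDerivOnHalfLine.unique {k l : ℕ}
    {v : Matrix (Fin k) (Fin l) ℝ → Matrix (Fin k) (Fin l) ℝ}
    (hv : ∀ i j, ContDiff ℝ 1 fun M : Fin k → Fin l → ℝ => v M i j)
    {M N : ℝ → Matrix (Fin k) (Fin l) ℝ} (hM : HasDerivOnHalfLine M fun t => v (M t))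
    (hN : HasDerivOnHalfLine N fun t => v (N t)) (h0 : M 0 = N 0) (t : ℝ) (ht : 0 ≤ t) :
    M t = N t :=
  eqOn_Ici_of_hasDerivWithinAt (E := Fin k → Fin l → ℝ) (v := fun M => v M)
    (contDiff_pi.2 fun i => contDiff_pi.2 fun j => hv i j)
    (fun t ht => hasDerivWithinAt_pi.2 fun i => hasDerivWithinAt_pi.2 fun j => hM t ht i j)
    (fun t ht => hasDerivWithinAt_pi.2 fun i => hasDerivWithinAt_pi.2 fun j => hN t ht i j) h0 t ht

theorem contDiff_matrix_mul {E : Type*} [NormedAddCommGroup E] [NormedSpace ℝ E] {k l m : ℕ}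
    {F : E → Matrix (Fin k) (Fin l) ℝ} {G : E → Matrix (Fin l) (Fin m) ℝ}
    (hF : ∀ i j, ContDiff ℝ 1 fun x => F x i j) (hG : ∀ i j, ContDiff ℝ 1 fun x => G x i j)
    (i : Fin k) (j : Fin m) : ContDiff ℝ 1 fun x => (F x * G x) i j := by
  simp only [mul_apply]
  exact ContDiff.sum fun q _ => (hF i q).mul (hG q j)

theorem contDiff_entry {k l : ℕ} (i : Fin k) (j : Fin l) :
    ContDiff ℝ 1 fun M : Fin k → Fin l → ℝ => M i j := by
  fun_prop

theorem contDiff_ojaField (A : Matrix (Fin n) (Fin n) ℝ) (i : Fin n) (j : Fin r) :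
    ContDiff ℝ 1 fun U : Fin n → Fin r → ℝ => ojaField A U i j := by
  have hsub : ∀ i j : Fin n, ContDiff ℝ 1 fun U : Fin n → Fin r → ℝ =>
      ((1 : Matrix (Fin n) (Fin n) ℝ) - Matrix.of U * (Matrix.of U)ᵀ) i j := fun i j =>
    contDiff_const.sub (contDiff_matrix_mul contDiff_entry (fun i j => contDiff_entry j i) i j)
  exact contDiff_matrix_mul (contDiff_matrix_mul hsub fun i j => contDiff_const (c := A i j))
    contDiff_entry i j

theorem contDiff_ric (a Q S : Matrix (Fin r) (Fin r) ℝ) (i j : Fin r) :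
    ContDiff ℝ 1 fun R : Fin r → Fin r → ℝ => ric a Q S R i j := by
  have hc : ∀ M : Matrix (Fin r) (Fin r) ℝ, ∀ i j : Fin r,
      ContDiff ℝ 1 fun _ : Fin r → Fin r → ℝ => M i j := fun _ _ _ => contDiff_const
  exact (((contDiff_matrix_mul (hc a) contDiff_entry i j).add
    (contDiff_matrix_mul contDiff_entry (hc aᵀ) i j)).add (hc Q i j)).sub
    (contDiff_matrix_mul (contDiff_matrix_mul contDiff_entry (hc S)) contDiff_entry i j)

theorem riccatiField_eq_ric {m : ℕ} (a : Matrix (Fin r) (Fin r) ℝ) (g : Matrix (Fin r) (Fin m) ℝ)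
    (c : Matrix (Fin p) (Fin r) ℝ) (H : Matrix (Fin p) (Fin p) ℝ) (R : Matrix (Fin r) (Fin r) ℝ) :
    riccatiField a g c H R = ric a (g * gᵀ) (cᵀ * (H * Hᵀ)⁻¹ * c) R := by
  simp only [riccatiField, ric, Matrix.mul_assoc]

variable {A G : Matrix (Fin n) (Fin n) ℝ} {C : Matrix (Fin p) (Fin n) ℝ}
  {H : Matrix (Fin p) (Fin p) ℝ}

/-- The filter equations are equivariant under a change of orthonormal basis. -/
theorem IsFilterSolution.conj {U : ℝ → Matrix (Fin n) (Fin r) ℝ} {R : ℝ → Matrix (Fin r) (Fin r) ℝ}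
    (h : IsFilterSolution A G C H U R) {O : Matrix (Fin r) (Fin r) ℝ} (hO : Oᵀ * O = 1) :
    IsFilterSolution A G C H (fun t => U t * Oᵀ) (fun t => O * R t * Oᵀ) := by
  have hO' : O * Oᵀ = 1 := mul_eq_one_comm.1 hO
  have hOl : ∀ {k : ℕ} (M : Matrix (Fin r) (Fin k) ℝ), Oᵀ * (O * M) = M := fun M => by
    rw [← Matrix.mul_assoc, hO, Matrix.one_mul]
  refine ⟨?_, ?_, ?_, ?_⟩
  · have h1 : (U 0)ᵀ * U 0 = 1 := h.stiefel_zero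
    change (U 0 * Oᵀ)ᵀ * (U 0 * Oᵀ) = 1
    rw [transpose_mul, transpose_transpose, Matrix.mul_assoc, ← Matrix.mul_assoc (U 0)ᵀ, h1,
      Matrix.one_mul, hO']
  · have := h.posDef_zero.mul_mul_conjTranspose_same (B := O) fun x y hxy => by
      have := congrArg (fun v => v ᵥ* Oᵀ) hxy
      simpa [hO'] using this
    simpa using this
  · convert h.oja.mul_const Oᵀ using 2 with t
    simp only [ojaField, transpose_mul, transpose_transpose, Matrix.mul_assoc, hOl,
      Matrix.sub_mul, Matrix.one_mul]
  · convert (h.riccati.const_mul O).mul_const Oᵀ using 2 with t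
    simp only [riccatiField, transpose_mul, transpose_transpose, Matrix.mul_assoc, hOl,
      Matrix.mul_add, Matrix.add_mul, Matrix.mul_sub, Matrix.sub_mul]

theorem ojaField_eq_zero_of_mem_ojaStableSet (hrn : r ≤ n) {U : Matrix (Fin n) (Fin r) ℝ}
    (hU : U ∈ ojaStableSet r A) : ojaField A U = 0 := by
  rw [ojaField, Matrix.sub_mul, Matrix.sub_mul, Matrix.one_mul, Matrix.mul_assoc _ A,
    Matrix.mul_assoc U, ← Matrix.mul_assoc Uᵀ, ← mul_eq_of_mem_ojaStableSet hrn hU, sub_self]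

/-- The Oja flow rests at the elements of the stable set. -/
theorem IsFilterSolution.eq_of_mem_ojaStableSet (hrn : r ≤ n)
    {U : ℝ → Matrix (Fin n) (Fin r) ℝ} {R : ℝ → Matrix (Fin r) (Fin r) ℝ}
    (h : IsFilterSolution A G C H U R) (hU : U 0 ∈ ojaStableSet r A) (t : ℝ) (ht : 0 ≤ t) :
    U t = U 0 := by
  refine h.oja.unique (N := fun _ => U 0) (contDiff_ojaField A) (fun s _ i j => ?_) rfl t ht
  rw [ojaField_eq_zero_of_mem_ojaStableSet hrn hU]
  exact hasDerivWithinAt_const s _ _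

/-- Observability passes to the invariant subspace spanned by an element of the stable set. -/
theorem reduced_observable (hrn : r ≤ n) (hH : (H * Hᵀ).PosDef) (hobs : IsObservable C A)
    {U : Matrix (Fin n) (Fin r) ℝ} (hU : U ∈ ojaStableSet r A) (x : Fin r → ℝ)
    (hx : ∀ k : ℕ, ((C * U)ᵀ * (H * Hᵀ)⁻¹ * (C * U)) *ᵥ ((Uᵀ * A * U) ^ k *ᵥ x) = 0) : x = 0 := by
  have hpow : ∀ k : ℕ, A ^ k * U = U * (Uᵀ * A * U) ^ k := by
    intro k
    induction k with
    | zero => simp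
    | succ k ih =>
      rw [pow_succ', Matrix.mul_assoc, ih, ← Matrix.mul_assoc, mul_eq_of_mem_ojaStableSet hrn hU,
        Matrix.mul_assoc U, ← pow_succ']
  have h1 : U *ᵥ x = 0 := by
    refine hobs.eq_zero fun k => ?_
    have h2 : C *ᵥ (A ^ k *ᵥ (U *ᵥ x)) = (C * U) *ᵥ ((Uᵀ * A * U) ^ k *ᵥ x) := by
      rw [mulVec_mulVec _ (A ^ k) U, hpow, ← mulVec_mulVec, mulVec_mulVec]
    rw [h2]
    refine PosDef.mulVec_eq_zero hH.inv ((posSemidef_mulVec_eq_zero_iff hH.inv.posSemidef _).1 ?_)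
    -- Pairing with the vector itself gives the quadratic form of `(H Hᵀ)⁻¹` at its image under `C
    -- U`; definiteness makes that image zero.
    have h3 := congrArg (fun v => ((Uᵀ * A * U) ^ k *ᵥ x) ⬝ᵥ v) (hx k)
    rwa [Matrix.mul_assoc (C * U)ᵀ, ← mulVec_mulVec, dotProduct_mulVec, vecMul_transpose,
      ← mulVec_mulVec _ (H * Hᵀ)⁻¹, dotProduct_zero] at h3
  have hU1 : Uᵀ * U = 1 := hU.1
  rw [← one_mulVec x, ← hU1, ← mulVec_mulVec, h1, mulVec_zero]

/-- Each element of the stable set has a steady-state reduced covariance. -/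
theorem exists_isSteadyStateCovariance (hrn : r ≤ n) (hH : (H * Hᵀ).PosDef)
    (hobs : IsObservable C A) {U : Matrix (Fin n) (Fin r) ℝ} (hU : U ∈ ojaStableSet r A) :
    ∃ P, IsSteadyStateCovariance A G C H U P := by
  have hQ : ((Uᵀ * G) * (Uᵀ * G)ᵀ).PosSemidef := by
    rw [← conjTranspose_eq_transpose_of_trivial (Uᵀ * G)]
    exact posSemidef_self_mul_conjTranspose (Uᵀ * G)
  have hS := posSemidef_transpose_mul_mul hH.inv.posSemidef (C * U)
  obtain ⟨P, hP⟩ := exists_riccati_limit (reduced_observable hrn hH hobs hU) hQ hS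
  refine ⟨P, fun R₀ hR₀ => ?_, fun Ut Rt h h0 => ?_⟩
  · obtain ⟨R, X, hR0, hR⟩ := exists_isRiccatiFlow (a := Uᵀ * A * U) hQ hS hR₀.posSemidef
    refine ⟨fun _ => U, R, ⟨hU.1, by rwa [hR0], fun t _ i j => ?_, fun t ht i j => ?_⟩, rfl, hR0⟩
    · rw [ojaField_eq_zero_of_mem_ojaStableSet hrn hU]
      exact hasDerivWithinAt_const t _ _
    · simp only [riccatiField_eq_ric]
      exact (hasDerivAt_matrix.1 (hR.hasDerivAt t ht) i j).hasDerivWithinAt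
  · obtain ⟨R, X, hR0, hR⟩ := exists_isRiccatiFlow (a := Uᵀ * A * U) hQ hS h.posDef_zero.posSemidef
    have hUt : ∀ t, 0 ≤ t → Ut t = U := fun t ht => by
      rw [h.eq_of_mem_ojaStableSet hrn (by rwa [h0]) t ht, h0]
    have heq : ∀ t, 0 ≤ t → R t = Rt t := by
      refine HasDerivOnHalfLine.unique (contDiff_ric (Uᵀ * A * U) _ _)
        (fun t ht i j => (hasDerivAt_matrix.1 (hR.hasDerivAt t ht) i j).hasDerivWithinAt)
        (fun t ht i j => ?_) hR0
      have := h.riccati t ht i j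
      simp only [hUt t ht, riccatiField_eq_ric] at this
      exact this
    refine (hP R X hR (by rw [hR0]; exact h.posDef_zero)).congr' ?_
    filter_upwards [eventually_ge_atTop 0] with t ht using heq t ht

/-- The steady-state reduced covariances at two elements of the stable set represent the same
covariance. -/
theorem IsSteadyStateCovariance.conj_eq (hrn : r ≤ n) {lam : Fin n → ℂ}
    (hlam : IsOrderedSpectrum A lam)
    (hgap : ∀ i j : Fin n, r ≤ i.val → j.val < r → (lam i).re < (lam j).re)
    {U₁ U₂ : Matrix (Fin n) (Fin r) ℝ} {P₁ P₂ : Matrix (Fin r) (Fin r) ℝ}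
    (hU₁ : U₁ ∈ ojaStableSet r A) (hU₂ : U₂ ∈ ojaStableSet r A)
    (h₁ : IsSteadyStateCovariance A G C H U₁ P₁) (h₂ : IsSteadyStateCovariance A G C H U₂ P₂) :
    U₁ * P₁ * U₁ᵀ = U₂ * P₂ * U₂ᵀ := by
  have h12 := eq_mul_of_mem_ojaStableSet hrn hlam hgap hU₁ hU₂
  have h21 := eq_mul_of_mem_ojaStableSet hrn hlam hgap hU₂ hU₁
  set O := U₂ᵀ * U₁ with hO
  have hOt : Oᵀ = U₁ᵀ * U₂ := by rw [hO, transpose_mul, transpose_transpose]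
  have hOO : Oᵀ * O = 1 := by
    rw [hOt, Matrix.mul_assoc, ← h12]
    exact hU₁.1
  obtain ⟨Ut, Rt, h, hUt, -⟩ := h₁.1 1 Matrix.PosDef.one
  -- The conjugated solution starts at `U₁ Oᵀ = U₂`, so its covariance tends to `P₂` as well as to
  -- `O P₁ Oᵀ`.
  have hlim := h₂.2 _ _ (h.conj hOO) (by rw [hUt, hOt, ← h21])
  have hlim' : Tendsto (fun t => O * Rt t * Oᵀ) atTop (𝓝 (O * P₁ * Oᵀ)) :=
    (show Continuous fun M : Matrix (Fin r) (Fin r) ℝ => O * M * Oᵀ by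
      fun_prop).continuousAt.tendsto
      |>.comp (h₁.2 Ut Rt h hUt)
  rw [← tendsto_nhds_unique hlim' hlim]
  nth_rw 1 2 [h12]
  simp only [transpose_mul, Matrix.mul_assoc]

end FilterSolution

end LRKB

/-! ### Assembly of the main theorem. -/

theorem mainTheorem6 {n r p : ℕ} (hr : 1 ≤ r) (hrn : r < n)
    (A G : Matrix (Fin n) (Fin n) ℝ) (C : Matrix (Fin p) (Fin n) ℝ)
    (H : Matrix (Fin p) (Fin p) ℝ) (hH : (H * H.transpose).PosDef)
    (lam : Fin n → ℂ) (hlam : LRKB.IsOrderedSpectrum A lam)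
    (hgap : (lam ⟨r, hrn⟩).re < (lam ⟨r - 1, by omega⟩).re)
    (hctrl : LRKB.IsControllable A G) (hobs : LRKB.IsObservable C A) :
    ∃ (Rtilde : Matrix (Fin n) (Fin r) ℝ → Matrix (Fin r) (Fin r) ℝ)
      (Pr : Matrix (Fin n) (Fin n) ℝ),
      (∀ U ∈ LRKB.ojaStableSet r A, LRKB.IsSteadyStateCovariance A G C H U (Rtilde U)) ∧
      (∀ (Ut : ℝ → Matrix (Fin n) (Fin r) ℝ) (Rt : ℝ → Matrix (Fin r) (Fin r) ℝ),
        LRKB.IsFilterSolution A G C H Ut Rt → Ut 0 ∈ LRKB.ojaStableSet r A →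
          Tendsto (fun t => Ut t * Rt t * (Ut t).transpose) atTop (𝓝 Pr)) ∧
      ∀ U₁ ∈ LRKB.ojaStableSet r A, ∀ U₂ ∈ LRKB.ojaStableSet r A,
        U₁ * Rtilde U₁ * U₁.transpose = U₂ * Rtilde U₂ * U₂.transpose ∧
        U₂ * Rtilde U₂ * U₂.transpose = Pr := by
  have key : ∀ U, U ∈ LRKB.ojaStableSet r A → ∃ P, LRKB.IsSteadyStateCovariance A G C H U P :=
    fun U hU => LRKB.exists_isSteadyStateCovariance hrn.le hH hobs hU
  choose! Rtilde hR using key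
  -- Indices start at `0`, so the gap sits between positions `r - 1` and `r`; monotonicity spreads
  -- it to all pairs across.
  have hsep : ∀ i j : Fin n, r ≤ i.val → j.val < r → (lam i).re < (lam j).re := fun i j hi hj =>
    (hlam.2 (Fin.le_def.2 hi)).trans_lt
      (hgap.trans_le (hlam.2 (Fin.le_def.2 (Nat.le_sub_one_of_lt hj))))
  have hconst : ∀ U₁ ∈ LRKB.ojaStableSet r A, ∀ U₂ ∈ LRKB.ojaStableSet r A,
      U₁ * Rtilde U₁ * U₁.transpose = U₂ * Rtilde U₂ * U₂.transpose := fun U₁ h₁ U₂ h₂ =>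
    (hR U₁ h₁).conj_eq hrn.le hlam hsep h₁ h₂ (hR U₂ h₂)
  obtain ⟨Pr, hPr⟩ : ∃ Pr, ∀ U ∈ LRKB.ojaStableSet r A, U * Rtilde U * U.transpose = Pr := by
    by_cases h : ∃ U, U ∈ LRKB.ojaStableSet r A
    · obtain ⟨U₀, hU₀⟩ := h
      exact ⟨_, fun U hU => hconst U hU U₀ hU₀⟩
    -- If the stable set is empty, any matrix serves; `0` is a filler.
    · exact ⟨0, fun U hU => absurd ⟨U, hU⟩ h⟩
  refine ⟨Rtilde, Pr, hR, fun Ut Rt h hU => ?_, fun U₁ h₁ U₂ h₂ => ⟨hconst U₁ h₁ U₂ h₂, hPr U₂ h₂⟩⟩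
  rw [← hPr _ hU]
  have hcont : Continuous fun M : Matrix (Fin r) (Fin r) ℝ => Ut 0 * M * (Ut 0).transpose := by
    fun_prop
  refine ((hcont.tendsto _).comp ((hR _ hU).2 Ut Rt h rfl)).congr' ?_
  filter_upwards [eventually_ge_atTop 0] with t ht
  rw [Function.comp_apply, h.eq_of_mem_ojaStableSet hrn.le hU t ht]
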